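/- For integers $n,r\ge 1$, $k\ge 0$ and a graph $G$ on the vertex set $[n]=\{1,\dots,n\}$, write $\mathcal E(S)=\{\{i,j\}: i\ne j\in S\}$ for $S\subseteq[n]$, and $k(i)=\binom{k}{2r-i}\big/\binom{2r}{2r-i}$ for $0\le i\le r$. For $T\subseteq [n]$ let $M_T$ be the real matrix with rows and columns indexed by the $r$-element subsets of $[n]$, where $$M_T(I,J)=\begin{cases}k(|I\cap J|) & \text{if } I\cup J\subseteq T \text{ and } \mathcal E(T)\setminus(\mathcal E(I)\cup\mathcal E(J))\subseteq E(G),\\ 0&\text{otherwise,}\end{cases}$$ and let $M'_r=M'_r(G)=\sum_{T\subseteq[n],\,|T|=2r}M_T$. Lemma (Main Technical Lemma). For every sufficiently large constant $c$ the following holds. If $r\ge 1$ and $r\le k<2^{-cr}\left(\sqrt n/\log n\right)^{1/r}$, then for a random graph $G\leftarrow G(n,1/2)$ the matrix $M'_r$ is positive definite with high probability, that is, with probability tending to $1$ as $n\to\infty$, uniformly over all such $r$ and $k$. Precisely: there is $c_0>0$ such that for every $c\ge c_0$ and every $\varepsilon>0$ there is $N$ such that for all $n\ge N$ and all integers $r,k$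 with $1\le r\le k<2^{-cr}\left(\sqrt n/\log n\right)^{1/r}$, $$\Pr_{G\leftarrow G(n,1/2)}\left[M'_r(G)\text{ is positive definite}\right]\ge 1-\varepsilon.$$ -/

import Mathlib

open MeasureTheory

namespace PlantedClique

/-- The law `G(n, 1/2)` of the random graph on the vertex set `Fin n` in which every pair of
distinct vertices is an edge independently with probability `1/2`. -/
noncomputable def gnHalf (n : ℕ) : Measure (SimpleGraph (Fin n)) :=
  SimpleGraph.binomialRandom (Fin n) ⟨1 / 2, by norm_num, by norm_num⟩

/-- `pairs S` is the set `{{i, j} : i ≠ j ∈ S}` of all potential edges inside `S`. -/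
def pairs {n : ℕ} (S : Finset (Fin n)) : Set (Sym2 (Fin n)) :=
  {e | ∃ i ∈ S, ∃ j ∈ S, i ≠ j ∧ e = s(i, j)}

/-- The index set of the matrices: the subsets of `[n]` of size exactly `r`. -/
abbrev Sub (n r : ℕ) : Type := {I : Finset (Fin n) // I.card = r}

/-- The coefficient `binom(k, 2r - i) / binom(2r, 2r - i)`, used for `0 ≤ i ≤ r`. -/
noncomputable def coeff (k r i : ℕ) : ℝ :=
  (k.choose (2 * r - i) : ℝ) / ((2 * r).choose (2 * r - i) : ℝ)

open Classical in
/-- The matrix `M_T`: the entry at `(I, J)` is `coeff k r |I ∩ J|` if `I ∪ J ⊆ T` and the only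
pairs inside `T` that are not edges of `G` lie inside `I` or inside `J`; it is `0` otherwise. -/
noncomputable def matrixOn {n : ℕ} (G : SimpleGraph (Fin n)) (k r : ℕ) (T : Finset (Fin n)) :
    Matrix (Sub n r) (Sub n r) ℝ :=
  Matrix.of fun I J =>
    if I.1 ∪ J.1 ⊆ T ∧ pairs T \ (pairs I.1 ∪ pairs J.1) ⊆ G.edgeSet then
      coeff k r (I.1 ∩ J.1).card
    else 0

/-- The filled-in matrix `M'_r`, the sum of `M_T` over all `T ⊆ [n]` with `|T| = 2r`. -/
noncomputable def filledMatrix {n : ℕ} (G : SimpleGraph (Fin n)) (k r : ℕ) :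
    Matrix (Sub n r) (Sub n r) ℝ :=
  ∑ T ∈ Finset.powersetCard (2 * r) (Finset.univ : Finset (Fin n)), matrixOn G k r T

end PlantedClique

/-! The entry at (I, J) factors as a coefficient depending on |I ∩ J|, times the indicator `cross`
that all pairs between I \ J and J \ I are edges, times the number of sets of |I ∩ J| new vertices
all of whose pairs with each other and with I ∪ J are edges (`filledMatrix_apply`). Replacing both
random factors by their means leaves `meanEntry`, a matrix depending only on |I ∩ J|; positivity is
proved for it and survives the fluctuation.

Mean: expand its entries in the binomials binom(|I ∩ J|, l). Each of these is a Gram matrix, and the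
one with l = r is the identity. The entries grow by a factor of at least 2^(r+1) as |I ∩ J|
increases by one, so all expansion coefficients are nonnegative and the quadratic form is at least
half the diagonal entry times the squared norm (`half_mul_le_sum_card_inter`).

Fluctuation: two events suffice, with K = 28 √n log n. `OpBound` bounds the signed adjacency matrix
in operator norm; `ComBound` bounds the error in the number of common neighbours of small sets. Each
fails with probability O(1/n), by Hoeffding and a union bound. Pairs (I, J) are grouped by Y = I ∩
J. Extension counts follow from common neighbours by adding one vertex at a time
(`abs_card_cliqueExt_sub_le`). `cross` is a product of adjacency indicators; after expansion in
signs, every nonconstant term contains the signed adjacency matrix in some pair of coordinates, and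
using its norm there and Cauchy–Schwarz elsewhere gains K/n over the trivial bound
(`OpBound.abs_sum_mul_prod_le`).

Relative to the common factor n^r `coeff k r r`, the fluctuation is at most 2 (K/n) 8^r k^r, while
the mean contributes at least 2^(-r-3r²)/2. The inequality k^r 2^(20 r²) log n < √n, which follows
from the hypothesis once c ≥ 20, separates the two. -/

namespace PlantedClique

/-! ### Edge signs and the uniform measure on graphs -/

open Classical in
/-- The Rademacher variable of the pair `u, v`: `1` on edges, `-1` on non-edges, `0` if `u = v`. -/
noncomputable def sgn {n : ℕ} (G : SimpleGraph (Fin n)) (u v : Fin n) : ℝ :=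
  if G.Adj u v then 1 else if u = v then 0 else -1

lemma sgn_self {n : ℕ} (G : SimpleGraph (Fin n)) (u : Fin n) : sgn G u u = 0 := by
  simp [sgn]

lemma sgn_comm {n : ℕ} (G : SimpleGraph (Fin n)) (u v : Fin n) : sgn G u v = sgn G v u := by
  classical exact if_congr (G.adj_comm u v) rfl (if_congr eq_comm rfl rfl)

lemma sgn_eq_or {n : ℕ} (G : SimpleGraph (Fin n)) {u v : Fin n} (h : u ≠ v) :
    sgn G u v = 1 ∨ sgn G u v = -1 := by
  unfold sgn; split_ifs <;> simp_all

lemma abs_sgn_le {n : ℕ} (G : SimpleGraph (Fin n)) (u v : Fin n) : |sgn G u v| ≤ 1 := by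
  unfold sgn; split_ifs <;> simp

open Classical in
lemma ite_adj_eq {n : ℕ} (G : SimpleGraph (Fin n)) {u v : Fin n} (h : u ≠ v) :
    (if G.Adj u v then (1 : ℝ) else 0) = (1 + sgn G u v) / 2 := by
  unfold sgn; split_ifs <;> norm_num

lemma sgn_symmDiff_edge {n : ℕ} (G : SimpleGraph (Fin n)) {a b : Fin n} (hab : a ≠ b)
    (u v : Fin n) :
    sgn (symmDiff G (SimpleGraph.edge a b)) u v =
      if s(u, v) = s(a, b) then -sgn G u v else sgn G u v := by
  have h : (symmDiff G (SimpleGraph.edge a b)).Adj u v ↔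
      (G.Adj u v ∧ ¬ s(u, v) = s(a, b)) ∨ (s(u, v) = s(a, b) ∧ ¬ G.Adj u v) := by
    simp only [symmDiff, SimpleGraph.sup_adj, SimpleGraph.sdiff_adj, SimpleGraph.edge_adj,
      Sym2.eq_iff]
    constructor
    · rintro (⟨h1, h2⟩ | ⟨⟨h1, h2⟩, h3⟩)
      · exact Or.inl ⟨h1, fun h => h2 ⟨h, h1.ne⟩⟩
      · exact Or.inr ⟨h1, h3⟩
    · rintro (⟨h1, h2⟩ | ⟨h1, h2⟩)
      · exact Or.inl ⟨h1, fun h => h2 h.1⟩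
      · refine Or.inr ⟨⟨h1, ?_⟩, h2⟩
        rintro rfl
        rcases h1 with ⟨h, h'⟩ | ⟨h, h'⟩ <;> exact hab (by rw [← h, ← h'])
  unfold sgn
  by_cases huv : s(u, v) = s(a, b)
  · have hne : u ≠ v := by
      rintro rfl
      rw [Sym2.eq_iff] at huv
      rcases huv with ⟨h, h'⟩ | ⟨h, h'⟩ <;> exact hab (by rw [← h, ← h'])
    by_cases hG : G.Adj u v <;> simp [h, huv, hG, hne]
  · by_cases hG : G.Adj u v <;> simp [h, huv, hG]

instance (n : ℕ) : IsProbabilityMeasure (gnHalf n) := by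
  unfold gnHalf; infer_instance

instance (n : ℕ) : MeasurableSingletonClass (SimpleGraph (Fin n)) where
  measurableSet_singleton G := by
    have h : ({G} : Set (SimpleGraph (Fin n))) = SimpleGraph.Adj ⁻¹' {G.Adj} := by
      ext H; exact ⟨fun h => congrArg _ h, fun h => SimpleGraph.ext h⟩
    rw [h]
    exact SimpleGraph.measurable_adj (measurableSet_singleton _)

/-- `G(n, 1/2)` is the uniform distribution. -/
lemma gnHalf_real_singleton {n : ℕ} (G : SimpleGraph (Fin n)) :
    (gnHalf n).real {G} = (1 / 2) ^ (n.choose 2) := by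
  have h : G.edgeSet.ncard ≤ n.choose 2 := by
    classical
    have h := G.card_edgeFinset_le_card_choose_two
    rw [Fintype.card_fin] at h
    rwa [← G.coe_edgeFinset, Set.ncard_coe_finset]
  unfold gnHalf
  rw [measureReal_def, SimpleGraph.binomialRandom_singleton]
  simp only [ENNReal.toReal_mul, ENNReal.toReal_pow, ENNReal.coe_toReal, Nat.card_eq_fintype_card,
    Fintype.card_fin, unitInterval.coe_toNNReal, unitInterval.coe_symm_eq]
  rw [show (1 - 1 / 2 : ℝ) = 1 / 2 by norm_num, ← pow_add]
  congr 1; omega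

/-- Toggling the pair of one index is an involution of the set of graphs, so it preserves the
uniform measure. It negates that factor and, the pairs being distinct, no other. -/
lemma integral_prod_sgn_eq_zero {n : ℕ} {ι : Type*} (S : Finset ι) (hS : S.Nonempty)
    (p q : ι → Fin n) (hpq : ∀ i ∈ S, p i ≠ q i)
    (hinj : ∀ i ∈ S, ∀ j ∈ S, s(p i, q i) = s(p j, q j) → i = j) :
    ∫ G, ∏ i ∈ S, sgn G (p i) (q i) ∂(gnHalf n) = 0 := by
  classical
  have := Fintype.ofFinite (SimpleGraph (Fin n))
  obtain ⟨a, ha⟩ := hS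
  rw [integral_fintype .of_finite]
  simp only [gnHalf_real_singleton, smul_eq_mul, ← Finset.mul_sum]
  refine mul_eq_zero_of_right _ ?_
  set E := SimpleGraph.edge (p a) (q a)
  have key : ∀ G : SimpleGraph (Fin n),
      ∏ i ∈ S, sgn (symmDiff G E) (p i) (q i) = - ∏ i ∈ S, sgn G (p i) (q i) := by
    intro G
    rw [← Finset.mul_prod_erase S _ ha, ← Finset.mul_prod_erase S _ ha,
      sgn_symmDiff_edge G (hpq a ha), if_pos rfl, neg_mul]
    congr 2
    refine Finset.prod_congr rfl fun i hi => ?_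
    rw [sgn_symmDiff_edge G (hpq a ha), if_neg]
    exact fun h => (Finset.ne_of_mem_erase hi) (hinj i (Finset.mem_of_mem_erase hi) a ha h)
  have h2 := Fintype.sum_bijective (fun G => symmDiff G E)
    (Function.Involutive.bijective fun G => by simp) _
    (fun G => ∏ i ∈ S, sgn G (p i) (q i)) (fun G => (key G).symm)
  rw [Finset.sum_neg_distrib] at h2
  linarith

/-! ### Hoeffding's inequality -/

/-- Hoeffding's inequality for a Rademacher-type system: signs all of whose nonempty
products have mean zero. -/
lemma measureReal_sum_ge_le {Ω ι : Type*} [Finite Ω] [MeasurableSpace Ω]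
    [MeasurableSingletonClass Ω] (μ : Measure Ω) [IsProbabilityMeasure μ] (s : Finset ι)
    (ξ : ι → Ω → ℝ) (c : ι → ℝ) (hξ : ∀ i ∈ s, ∀ ω, ξ i ω = 1 ∨ ξ i ω = -1)
    (h0 : ∀ S ⊆ s, S.Nonempty → ∫ ω, ∏ i ∈ S, ξ i ω ∂μ = 0)
    {σ t : ℝ} (hσ : 0 < σ) (hc : ∑ i ∈ s, c i ^ 2 ≤ σ) (ht : 0 ≤ t) :
    μ.real {ω | t ≤ ∑ i ∈ s, c i * ξ i ω} ≤ Real.exp (-t ^ 2 / (2 * σ)) := by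
  classical
  -- For ξ = ±1, exp(aξ) = cosh a + ξ sinh a. In the expanded product only the empty set has nonzero
  -- mean, so the moment generating function is that of independent signs.
  have hexp : ∀ a : ℝ, ∫ ω, Real.exp (a * ∑ i ∈ s, c i * ξ i ω) ∂μ =
      ∏ i ∈ s, Real.cosh (a * c i) := by
    intro a
    have h1 : ∀ ω, Real.exp (a * ∑ i ∈ s, c i * ξ i ω) =
        ∑ S ∈ s.powerset, ((∏ i ∈ S, Real.sinh (a * c i)) *
          ∏ i ∈ s \ S, Real.cosh (a * c i)) * ∏ i ∈ S, ξ i ω := by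
      intro ω
      rw [Finset.mul_sum, Real.exp_sum, ← Finset.prod_congr rfl (g := fun i =>
        Real.exp (a * (c i * ξ i ω))) (f := fun i =>
          Real.sinh (a * c i) * ξ i ω + Real.cosh (a * c i)), Finset.prod_add]
      · refine Finset.sum_congr rfl fun S _ => ?_
        rw [Finset.prod_mul_distrib]; ring
      · intro i hi
        rcases hξ i hi ω with h | h <;> rw [h]
        · rw [mul_one, mul_one, add_comm, Real.cosh_add_sinh]
        · rw [mul_neg_one, mul_neg_one, mul_neg, ← Real.cosh_sub_sinh]; ring
    simp_rw [h1]
    rw [integral_finsetSum _ fun _ _ => .of_finite, Finset.sum_eq_single ∅]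
    · simp
    · intro S hS hne
      rw [integral_const_mul, h0 S (Finset.mem_powerset.1 hS)
        (Finset.nonempty_iff_ne_empty.2 hne), mul_zero]
    · simp
  have hmgf : ProbabilityTheory.HasSubgaussianMGF (fun ω => ∑ i ∈ s, c i * ξ i ω)
      ⟨σ, hσ.le⟩ μ := by
    refine ⟨fun _ => .of_finite, fun a => ?_⟩
    rw [ProbabilityTheory.mgf, hexp]
    calc ∏ i ∈ s, Real.cosh (a * c i) ≤ ∏ i ∈ s, Real.exp ((a * c i) ^ 2 / 2) :=
          Finset.prod_le_prod (fun _ _ => (Real.cosh_pos _).le)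
            fun _ _ => Real.cosh_le_exp_half_sq _
      _ = Real.exp (a ^ 2 / 2 * ∑ i ∈ s, c i ^ 2) := by
          rw [← Real.exp_sum, Finset.mul_sum]
          congr 1; exact Finset.sum_congr rfl fun i _ => by ring
      _ ≤ _ := by
          apply Real.exp_le_exp.2
          show _ ≤ σ * a ^ 2 / 2
          nlinarith [sq_nonneg a]
  exact hmgf.measure_ge_le ht

/-! ### The two pseudorandomness events -/

/-- The signed adjacency matrix of `G` has operator norm at most `K`. -/
def OpBound {n : ℕ} (G : SimpleGraph (Fin n)) (K : ℝ) : Prop :=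
  ∀ x y : Fin n → ℝ, ∑ u, ∑ v, sgn G u v * x u * y v ≤
    K * (Real.sqrt (∑ u, x u ^ 2) * Real.sqrt (∑ v, y v ^ 2))

open Classical in
/-- The common neighbours of the vertices in `U`. -/
noncomputable def common {n : ℕ} (G : SimpleGraph (Fin n)) (U : Finset (Fin n)) :
    Finset (Fin n) :=
  Finset.univ.filter fun w => w ∉ U ∧ ∀ u ∈ U, G.Adj u w

/-- All sets of at most `m` vertices have about the expected number of common neighbours. -/
def ComBound {n : ℕ} (G : SimpleGraph (Fin n)) (m : ℕ) (K : ℝ) : Prop :=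
  ∀ U : Finset (Fin n), U.card ≤ m →
    |((common G U).card : ℝ) - ((n : ℝ) - U.card) * (1 / 2) ^ U.card| ≤ K

/-! ### Operator norm of the signed adjacency matrix -/

/-- The bilinear form of the strictly upper triangular part of the signed adjacency matrix. -/
noncomputable def upper {n : ℕ} (G : SimpleGraph (Fin n)) (x y : Fin n → ℝ) : ℝ :=
  ∑ p ∈ Finset.univ.filter (fun p : Fin n × Fin n => p.1 < p.2),
    (x p.1 * y p.2) * sgn G p.1 p.2

/-- The full form uses each edge sign twice, whereas Hoeffding needs distinct signs; each triangular
half uses every sign once. -/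
lemma sum_sgn_eq_upper {n : ℕ} (G : SimpleGraph (Fin n)) (x y : Fin n → ℝ) :
    ∑ u, ∑ v, sgn G u v * x u * y v = upper G x y + upper G y x := by
  classical
  have h2 : upper G y x = ∑ p ∈ Finset.univ.filter (fun p : Fin n × Fin n => p.2 < p.1),
      (x p.1 * y p.2) * sgn G p.1 p.2 := by
    unfold upper
    refine Finset.sum_nbij' Prod.swap Prod.swap ?_ ?_ ?_ ?_ ?_ <;> simp
    intro a b _
    rw [sgn_comm]; ring
  rw [h2, upper, Finset.sum_filter, Finset.sum_filter, ← Finset.sum_add_distrib,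
    ← Finset.sum_product', Finset.univ_product_univ]
  refine Finset.sum_congr rfl fun p _ => ?_
  rcases lt_trichotomy p.1 p.2 with h | h | h
  · simp [h, h.not_gt]; ring
  · simp [h, sgn_self]
  · simp [h, h.not_gt]; ring

lemma measureReal_upper_ge_le {n : ℕ} (z w : Fin n → ℝ) (hn : 0 < n)
    (hz : ∑ i, z i ^ 2 ≤ 4 * n) (hw : ∑ i, w i ^ 2 ≤ 4 * n) {t : ℝ} (ht : 0 ≤ t) :
    (gnHalf n).real {G | t ≤ upper G z w} ≤ Real.exp (-t ^ 2 / (2 * (16 * (n : ℝ) ^ 2))) := by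
  classical
  have hn' : (0 : ℝ) < n := by exact_mod_cast hn
  refine measureReal_sum_ge_le (gnHalf n)
    (Finset.univ.filter fun p : Fin n × Fin n => p.1 < p.2) (fun p G => sgn G p.1 p.2)
    (fun p => z p.1 * w p.2) (σ := 16 * (n : ℝ) ^ 2) (t := t)
    (fun p hp G => sgn_eq_or G (Finset.mem_filter.1 hp).2.ne) ?_ (by positivity) ?_ ht
  · intro S hS hne
    refine integral_prod_sgn_eq_zero S hne _ _ (fun p hp => (Finset.mem_filter.1 (hS hp)).2.ne) ?_
    intro p hp q hq h
    have h1 := (Finset.mem_filter.1 (hS hp)).2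
    have h2 := (Finset.mem_filter.1 (hS hq)).2
    rw [Sym2.eq_iff] at h
    rcases h with ⟨h, h'⟩ | ⟨h, h'⟩
    · exact Prod.ext h h'
    · rw [h, h'] at h1; exact absurd h1 h2.not_gt
  · calc ∑ p ∈ Finset.univ.filter (fun p : Fin n × Fin n => p.1 < p.2), (z p.1 * w p.2) ^ 2
        ≤ ∑ p : Fin n × Fin n, (z p.1 * w p.2) ^ 2 :=
          Finset.sum_le_sum_of_subset_of_nonneg (Finset.filter_subset _ _)
            fun _ _ _ => sq_nonneg _
      _ = (∑ i, z i ^ 2) * ∑ i, w i ^ 2 := by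
          rw [Finset.sum_mul_sum, ← Finset.univ_product_univ, Finset.sum_product]
          simp [mul_pow]
      _ ≤ (4 * n) * (4 * n) := by gcongr
      _ = _ := by ring

/-- Rounding a vector to integers so that a linear functional does not decrease. -/
lemma exists_int_round {n : ℕ} (hn : 4 ≤ n) (c x : Fin n → ℝ) (hx : ∑ i, x i ^ 2 ≤ n) :
    ∃ z ∈ Fintype.piFinset fun _ : Fin n => Finset.Icc (-(n : ℤ)) n,
      ∑ i, (z i : ℝ) ^ 2 ≤ 4 * n ∧ ∑ i, c i * x i ≤ ∑ i, c i * (z i : ℝ) := by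
  classical
  -- Each coordinate is rounded in the direction in which the functional increases.
  set z : Fin n → ℤ := fun i => if 0 ≤ c i then ⌈x i⌉ else ⌊x i⌋ with hz
  have h1 : ∀ i, |(z i : ℝ) - x i| ≤ 1 := by
    intro i
    simp only [hz]
    split_ifs
    · rw [abs_le]; constructor <;> linarith [Int.le_ceil (x i), Int.ceil_lt_add_one (x i)]
    · rw [abs_le]; constructor <;> linarith [Int.floor_le (x i), Int.lt_floor_add_one (x i)]
  have h2 : ∑ i, (z i : ℝ) ^ 2 ≤ 4 * n := by
    calc ∑ i, (z i : ℝ) ^ 2 ≤ ∑ i, (2 * x i ^ 2 + 2) := by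
          refine Finset.sum_le_sum fun i _ => ?_
          have h3 : ((z i : ℝ) - x i) ^ 2 ≤ 1 := (sq_le_one_iff_abs_le_one _).2 (h1 i)
          nlinarith [sq_nonneg ((z i : ℝ) - 2 * x i)]
      _ ≤ _ := by
          rw [Finset.sum_add_distrib, ← Finset.mul_sum]
          simp; linarith
  refine ⟨z, ?_, h2, ?_⟩
  · rw [Fintype.mem_piFinset]
    intro i
    have h3 : (z i : ℝ) ^ 2 ≤ 4 * n :=
      (Finset.single_le_sum (f := fun i => (z i : ℝ) ^ 2) (fun _ _ => sq_nonneg _)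
        (Finset.mem_univ i)).trans h2
    -- The coordinates are at most 2√n, which is at most n because n ≥ 4.
    have h4 : (4 : ℝ) ≤ n := by exact_mod_cast hn
    have h5 : |(z i : ℝ)| ≤ n := abs_le_of_sq_le_sq (by nlinarith) (by positivity)
    rw [Finset.mem_Icc, ← abs_le]
    exact_mod_cast h5
  · refine Finset.sum_le_sum fun i _ => ?_
    simp only [hz]
    split_ifs with h
    · exact mul_le_mul_of_nonneg_left (Int.le_ceil _) h
    · exact mul_le_mul_of_nonpos_left (Int.floor_le _) (not_le.1 h).le

lemma upper_eq_left {n : ℕ} (G : SimpleGraph (Fin n)) (x y : Fin n → ℝ) :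
    upper G x y = ∑ u, (∑ v, if u < v then y v * sgn G u v else 0) * x u := by
  rw [upper, Finset.sum_filter, ← Finset.univ_product_univ, Finset.sum_product]
  refine Finset.sum_congr rfl fun u _ => ?_
  rw [Finset.sum_mul]
  refine Finset.sum_congr rfl fun v _ => ?_
  split_ifs <;> ring

lemma upper_eq_right {n : ℕ} (G : SimpleGraph (Fin n)) (x y : Fin n → ℝ) :
    upper G x y = ∑ v, (∑ u, if u < v then x u * sgn G u v else 0) * y v := by
  rw [upper, Finset.sum_filter, ← Finset.univ_product_univ, Finset.sum_product_right]
  refine Finset.sum_congr rfl fun u _ => ?_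
  rw [Finset.sum_mul]
  refine Finset.sum_congr rfl fun v _ => ?_
  split_ifs <;> ring

lemma upper_smul {n : ℕ} (G : SimpleGraph (Fin n)) (a b : ℝ) (x y : Fin n → ℝ) :
    upper G (fun u => a * x u) (fun u => b * y u) = a * b * upper G x y := by
  unfold upper
  rw [Finset.mul_sum]
  exact Finset.sum_congr rfl fun _ _ => by ring

/-- The form is linear in each argument, so on the ball of radius √n the two vectors can be rounded
one after the other without decreasing it. Integer vectors thus replace a net, with no approximation
error; homogeneity gives all other vectors. -/
lemma upper_le_of_int {n : ℕ} (hn : 4 ≤ n) {G : SimpleGraph (Fin n)} {t : ℝ}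
    (h : ∀ z ∈ Fintype.piFinset fun _ : Fin n => Finset.Icc (-(n : ℤ)) n,
      ∀ w ∈ Fintype.piFinset fun _ : Fin n => Finset.Icc (-(n : ℤ)) n,
      ∑ i, (z i : ℝ) ^ 2 ≤ 4 * n → ∑ i, (w i : ℝ) ^ 2 ≤ 4 * n →
      upper G (fun i => z i) (fun i => w i) ≤ t) (x y : Fin n → ℝ) :
    upper G x y ≤ t / n * (Real.sqrt (∑ u, x u ^ 2) * Real.sqrt (∑ v, y v ^ 2)) := by
  have hn' : (0 : ℝ) < n := by exact_mod_cast (by omega : 0 < n)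
  have key : ∀ x y : Fin n → ℝ, ∑ i, x i ^ 2 ≤ n → ∑ i, y i ^ 2 ≤ n → upper G x y ≤ t := by
    intro x y hx hy
    obtain ⟨z, hz, hz2, hz3⟩ := exists_int_round hn
      (fun u => ∑ v, if u < v then y v * sgn G u v else 0) x hx
    rw [← upper_eq_left, ← upper_eq_left] at hz3
    obtain ⟨w, hw, hw2, hw3⟩ := exists_int_round hn
      (fun v => ∑ u, if u < v then (z u : ℝ) * sgn G u v else 0) y hy
    rw [← upper_eq_right G (fun i => (z i : ℝ)), ← upper_eq_right G (fun i => (z i : ℝ))] at hw3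
    exact hz3.trans (hw3.trans (h z hz w hw hz2 hw2))
  have hzero : ∀ x : Fin n → ℝ, Real.sqrt (∑ u, x u ^ 2) = 0 → ∀ u, x u = 0 := by
    intro x hx u
    rw [Real.sqrt_eq_zero (Finset.sum_nonneg fun _ _ => sq_nonneg _),
      Finset.sum_eq_zero_iff_of_nonneg fun _ _ => sq_nonneg _] at hx
    exact pow_eq_zero_iff (two_ne_zero) |>.1 (hx u (Finset.mem_univ u))
  set X := Real.sqrt (∑ u, x u ^ 2) with hX
  set Y := Real.sqrt (∑ u, y u ^ 2) with hY
  rcases eq_or_ne X 0 with hX0 | hX0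
  · rw [hX0]; simp [upper, hzero x hX0]
  rcases eq_or_ne Y 0 with hY0 | hY0
  · rw [hY0]; simp [upper, hzero y hY0]
  have hXp : 0 < X := lt_of_le_of_ne (Real.sqrt_nonneg _) hX0.symm
  have hYp : 0 < Y := lt_of_le_of_ne (Real.sqrt_nonneg _) hY0.symm
  have hnorm : ∀ x : Fin n → ℝ, Real.sqrt (∑ u, x u ^ 2) ≠ 0 →
      ∑ u, (Real.sqrt n / Real.sqrt (∑ u, x u ^ 2) * x u) ^ 2 ≤ n := by
    intro x hx
    simp_rw [mul_pow, div_pow]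
    rw [← Finset.mul_sum, Real.sq_sqrt hn'.le,
      Real.sq_sqrt (Finset.sum_nonneg fun _ _ => sq_nonneg _), div_mul_cancel₀]
    intro h0; exact hx (by rw [h0, Real.sqrt_zero])
  have h1 := key _ _ (hnorm x hX0) (hnorm y hY0)
  rw [upper_smul, ← hX, ← hY] at h1
  have h2 : Real.sqrt n / X * (Real.sqrt n / Y) * upper G x y = n / (X * Y) * upper G x y := by
    rw [div_mul_div_comm, Real.mul_self_sqrt hn'.le]
  rw [h2, div_mul_eq_mul_div, div_le_iff₀ (by positivity)] at h1
  rw [div_mul_eq_mul_div, le_div_iff₀ hn']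
  linarith

lemma opBound_of_int {n : ℕ} (hn : 4 ≤ n) {G : SimpleGraph (Fin n)} {t : ℝ}
    (h : ∀ z ∈ Fintype.piFinset fun _ : Fin n => Finset.Icc (-(n : ℤ)) n,
      ∀ w ∈ Fintype.piFinset fun _ : Fin n => Finset.Icc (-(n : ℤ)) n,
      ∑ i, (z i : ℝ) ^ 2 ≤ 4 * n → ∑ i, (w i : ℝ) ^ 2 ≤ 4 * n →
      upper G (fun i => z i) (fun i => w i) ≤ t) : OpBound G (2 * (t / n)) := by
  intro x y
  rw [sum_sgn_eq_upper]
  have h1 := upper_le_of_int hn h x y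
  have h2 := upper_le_of_int hn h y x
  rw [mul_comm (Real.sqrt (∑ u, y u ^ 2))] at h2
  linarith

lemma OpBound.mono {n : ℕ} {G : SimpleGraph (Fin n)} {K K' : ℝ} (h : OpBound G K) (hK : K ≤ K') :
    OpBound G K' := fun x y => (h x y).trans (by gcongr)

open Real in
lemma measureReal_not_opBound_le {n : ℕ} (hn : 4 ≤ n) :
    (gnHalf n).real {G | ¬ OpBound G (28 * (√n * log n))} ≤ 1 / n := by
  classical
  have hn' : (4 : ℝ) ≤ n := by exact_mod_cast hn
  have hn0 : (0 : ℝ) < n := by linarith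
  set L := log n with hL
  have hL1 : 1 ≤ L := by
    rw [hL, le_log_iff_exp_le hn0]; linarith [exp_one_lt_d9]
  -- With variance proxy 16n², the Hoeffding exponent is 6nL, which beats the at most exp(4nL) pairs
  -- of integer vectors. The constant 28 comes from 2√(192 L) ≤ 28 L, valid for L ≥ 1.
  set t : ℝ := n * (√n * √(192 * L)) with ht
  have ht0 : 0 ≤ t := by positivity
  have ht2 : t ^ 2 = n ^ 2 * (n * (192 * L)) := by
    rw [ht, mul_pow, mul_pow, sq_sqrt hn0.le, sq_sqrt (by positivity)]
  set B := (Fintype.piFinset fun _ : Fin n => Finset.Icc (-(n : ℤ)) n) with hB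
  set P := (B ×ˢ B).filter fun q =>
    ∑ i, (q.1 i : ℝ) ^ 2 ≤ 4 * n ∧ ∑ i, (q.2 i : ℝ) ^ 2 ≤ 4 * n with hP
  have hsub : {G : SimpleGraph (Fin n) | ¬ OpBound G (28 * (√n * L))} ⊆
      ⋃ q ∈ P, {G | t ≤ upper G (fun i => q.1 i) (fun i => q.2 i)} := by
    intro G hG
    by_contra hcon
    apply hG
    have h1 : OpBound G (2 * (t / n)) := by
      refine opBound_of_int hn fun z hz w hw hz2 hw2 => ?_
      by_contra hlt
      exact hcon (Set.mem_biUnion (show (z, w) ∈ P by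
        rw [hP, Finset.mem_filter, Finset.mem_product]; exact ⟨⟨hz, hw⟩, hz2, hw2⟩)
        (not_le.1 hlt).le)
    refine h1.mono ?_
    rw [ht, mul_div_cancel_left₀ _ hn0.ne']
    have h3 : √(192 * L) ≤ 14 * L := by
      rw [sqrt_le_left (by positivity)]; nlinarith
    nlinarith [sqrt_nonneg n]
  have hcard : (P.card : ℝ) ≤ exp (4 * n * L) := by
    have h1 : P.card ≤ ((2 * n + 1) ^ n) * ((2 * n + 1) ^ n) := by
      refine (Finset.card_filter_le _ _).trans ?_
      rw [Finset.card_product, hB, Fintype.card_piFinset]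
      simp only [Int.card_Icc, Finset.prod_const, Finset.card_univ, Fintype.card_fin]
      have : ((n : ℤ) + 1 - -n).toNat = 2 * n + 1 := by omega
      rw [this]
    have h2 : (P.card : ℝ) ≤ ((2 * n + 1) ^ n) * ((2 * n + 1) ^ n) := by exact_mod_cast h1
    refine h2.trans ?_
    have h3 : (2 * n + 1 : ℝ) ≤ exp (2 * L) := by
      rw [two_mul L, exp_add, hL, exp_log hn0]; nlinarith
    calc ((2 * n + 1 : ℝ) ^ n) * ((2 * n + 1) ^ n) ≤ exp (2 * L) ^ n * exp (2 * L) ^ n := by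
          gcongr
      _ = _ := by rw [← exp_nat_mul, ← exp_add]; congr 1; ring
  calc (gnHalf n).real {G | ¬ OpBound G (28 * (√n * L))}
      ≤ (gnHalf n).real (⋃ q ∈ P, {G | t ≤ upper G (fun i => q.1 i) (fun i => q.2 i)}) :=
        measureReal_mono hsub (measure_ne_top _ _)
    _ ≤ ∑ q ∈ P, (gnHalf n).real {G | t ≤ upper G (fun i => q.1 i) (fun i => q.2 i)} :=
        measureReal_biUnion_finset_le _ _
    _ ≤ ∑ q ∈ P, exp (-t ^ 2 / (2 * (16 * (n : ℝ) ^ 2))) := by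
        refine Finset.sum_le_sum fun q hq => ?_
        rw [hP, Finset.mem_filter] at hq
        exact measureReal_upper_ge_le _ _ (by omega) hq.2.1 hq.2.2 ht0
    _ = P.card * exp (-(6 * n * L)) := by
        rw [Finset.sum_const, nsmul_eq_mul, ht2]; congr 2
        field_simp; norm_num
    _ ≤ exp (4 * n * L) * exp (-(6 * n * L)) := by gcongr
    _ ≤ exp (-L) := by rw [← exp_add]; apply exp_le_exp.2; nlinarith
    _ = 1 / n := by rw [exp_neg, hL, exp_log hn0, one_div]

/-! ### Common neighbourhoods of small sets -/

/-- Fourier expansion of the product of (1 + sign)/2 over U; N = ∅ is the main term. -/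
lemma card_common_eq {n : ℕ} (G : SimpleGraph (Fin n)) (U : Finset (Fin n)) :
    ((common G U).card : ℝ) =
      (1 / 2) ^ U.card * ∑ N ∈ U.powerset, ∑ w ∈ Uᶜ, ∏ u ∈ N, sgn G u w := by
  classical
  have h1 : ((common G U).card : ℝ) = ∑ w ∈ Uᶜ, ∏ u ∈ U, (if G.Adj u w then (1 : ℝ) else 0) := by
    rw [common, Finset.card_eq_sum_ones, Nat.cast_sum, Finset.sum_filter,
      ← Finset.sum_filter_add_sum_filter_not Finset.univ (fun w => w ∈ U), Finset.sum_eq_zero,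
      zero_add]
    · refine Finset.sum_congr (by ext; simp) fun w hw => ?_
      rw [Finset.mem_compl] at hw
      rw [Finset.prod_ite_zero]
      simp [hw]
    · intro w hw
      simp [(Finset.mem_filter.1 hw).2]
  rw [h1, Finset.sum_comm, Finset.mul_sum]
  refine Finset.sum_congr rfl fun w hw => ?_
  rw [Finset.mem_compl] at hw
  rw [Finset.prod_congr rfl fun u hu => ite_adj_eq G (u := u) (v := w) (by rintro rfl; exact hw hu)]
  simp_rw [div_eq_mul_one_div ((1 : ℝ) + _)]
  rw [Finset.prod_mul_distrib, Finset.prod_const, Finset.prod_one_add, mul_comm]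

/-- The products over N are themselves signs indexed by w, and a product of several of them runs
over distinct pairs, so Hoeffding applies. The sign c provides both tails. -/
lemma measureReal_star_ge_le {n : ℕ} (hn : 0 < n) {U N : Finset (Fin n)} (hNU : N ⊆ U)
    (hN : N.Nonempty) {c : ℝ} (hc : c = 1 ∨ c = -1) {t : ℝ} (ht : 0 ≤ t) :
    (gnHalf n).real {G | t ≤ ∑ w ∈ Uᶜ, c * ∏ u ∈ N, sgn G u w} ≤
      Real.exp (-t ^ 2 / (2 * (n : ℝ))) := by
  classical
  have hne : ∀ u ∈ N, ∀ w ∈ Uᶜ, u ≠ w := by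
    rintro u hu w hw rfl
    exact (Finset.mem_compl.1 hw) (hNU hu)
  refine measureReal_sum_ge_le (gnHalf n) Uᶜ (fun w G => ∏ u ∈ N, sgn G u w) (fun _ => c)
    (σ := n) (t := t) ?_ ?_ (by exact_mod_cast hn) ?_ ht
  · intro w hw G
    refine Finset.prod_induction _ (fun x : ℝ => x = 1 ∨ x = -1) ?_ (Or.inl rfl)
      fun u hu => sgn_eq_or G (hne u hu w hw)
    rintro a b (rfl | rfl) (rfl | rfl) <;> norm_num
  · intro S hS hS0
    simp_rw [← Finset.prod_product']
    refine integral_prod_sgn_eq_zero (S ×ˢ N) (hS0.product hN) (fun p => p.2) (fun p => p.1) ?_ ?_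
    · intro p hp
      rw [Finset.mem_product] at hp
      exact hne _ hp.2 _ (hS hp.1)
    · intro p hp q hq h
      rw [Finset.mem_product] at hp hq
      rw [Sym2.eq_iff] at h
      rcases h with ⟨h, h'⟩ | ⟨h, h'⟩
      · exact Prod.ext h' h
      · exact absurd h (hne _ hp.2 _ (hS hq.1))
  · have : c ^ 2 = 1 := by rcases hc with rfl | rfl <;> norm_num
    rw [this]
    simp only [Finset.sum_const, nsmul_eq_mul, mul_one]
    exact_mod_cast (Finset.card_le_univ _).trans (Fintype.card_fin n).le

lemma card_filter_card_le {n m : ℕ} :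
    ((Finset.univ : Finset (Finset (Fin n))).filter fun U => U.card ≤ m).card ≤ (n + 1) ^ m := by
  classical
  have h : ((Finset.univ : Finset (Finset (Fin n))).filter fun U => U.card ≤ m) ⊆
      (Finset.range (m + 1)).biUnion fun j => Finset.powersetCard j Finset.univ := by
    intro U hU
    simpa [Nat.lt_succ_iff] using hU
  calc _ ≤ _ := Finset.card_le_card h
    _ ≤ ∑ j ∈ Finset.range (m + 1), (Finset.powersetCard j (Finset.univ : Finset (Fin n))).card :=
        Finset.card_biUnion_le
    _ = ∑ j ∈ Finset.range (m + 1), n.choose j := by simp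
    _ ≤ ∑ j ∈ Finset.range (m + 1), n ^ j * 1 ^ (m - j) * m.choose j := by
        refine Finset.sum_le_sum fun j hj => ?_
        rw [one_pow, mul_one]
        have : 0 < m.choose j := Nat.choose_pos (Nat.lt_succ_iff.1 (Finset.mem_range.1 hj))
        exact (Nat.choose_le_pow n j).trans (Nat.le_mul_of_pos_right _ this)
    _ = (n + 1) ^ m := by rw [add_pow]; simp

/-- There are fewer than 2^|U| nonconstant characters and the prefactor is 2^(-|U|), so the bound K
passes through without loss. -/
lemma comBound_of_star {n m : ℕ} {G : SimpleGraph (Fin n)} {K : ℝ} (hK : 0 ≤ K)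
    (h : ∀ U : Finset (Fin n), U.card ≤ m → ∀ N ⊆ U, N.Nonempty →
      |∑ w ∈ Uᶜ, ∏ u ∈ N, sgn G u w| ≤ K) : ComBound G m K := by
  classical
  intro U hU
  rw [card_common_eq, ← Finset.add_sum_erase U.powerset _ (Finset.empty_mem_powerset U)]
  have h1 : ∑ w ∈ Uᶜ, ∏ u ∈ (∅ : Finset (Fin n)), sgn G u w = (n : ℝ) - U.card := by
    simp only [Finset.prod_empty, Finset.sum_const, nsmul_eq_mul, mul_one]
    rw [Finset.card_compl, Fintype.card_fin, Nat.cast_sub]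
    simpa using Finset.card_le_univ U
  rw [h1, mul_add, mul_comm ((1 / 2 : ℝ) ^ U.card) ((n : ℝ) - _), add_sub_cancel_left, abs_mul,
    abs_of_nonneg (by positivity)]
  calc (1 / 2 : ℝ) ^ U.card * |∑ N ∈ U.powerset.erase ∅, ∑ w ∈ Uᶜ, ∏ u ∈ N, sgn G u w|
      ≤ (1 / 2 : ℝ) ^ U.card * ∑ N ∈ U.powerset.erase ∅, K := by
        gcongr
        refine (Finset.abs_sum_le_sum_abs _ _).trans (Finset.sum_le_sum fun N hN => ?_)
        rw [Finset.mem_erase, Finset.mem_powerset] at hN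
        exact h U hU N hN.2 (Finset.nonempty_iff_ne_empty.2 hN.1)
    _ ≤ (1 / 2 : ℝ) ^ U.card * (2 ^ U.card * K) := by
        rw [Finset.sum_const, nsmul_eq_mul]
        gcongr
        refine (Nat.cast_le.2 (Finset.card_le_card (Finset.erase_subset _ _))).trans ?_
        rw [Finset.card_powerset]; norm_num
    _ = K := by rw [← mul_assoc, ← mul_pow]; norm_num

open Real in
lemma measureReal_not_comBound_le {n m : ℕ} (hn : 4 ≤ n) (hm : m ≤ log n) :
    (gnHalf n).real {G | ¬ ComBound G m (28 * (√n * log n))} ≤ 2 / n := by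
  classical
  have hn' : (4 : ℝ) ≤ n := by exact_mod_cast hn
  have hn0 : (0 : ℝ) < n := by linarith
  set L := log n with hL
  have hL1 : 1 ≤ L := by
    rw [hL, le_log_iff_exp_le hn0]; linarith [exp_one_lt_d9]
  set K : ℝ := 28 * (√n * L) with hKdef
  have hK0 : 0 ≤ K := by positivity
  -- The exponent 4L² beats the at most exp(2L²) pairs N ⊆ U; that count is where m ≤ log n enters.
  have hK2 : -K ^ 2 / (2 * n) ≤ -(4 * L ^ 2) := by
    rw [hKdef, mul_pow, mul_pow, sq_sqrt hn0.le, div_le_iff₀ (by positivity)]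
    have : 0 ≤ n * L ^ 2 := by positivity
    nlinarith
  set B := ((Finset.univ : Finset (Finset (Fin n))).filter fun U => U.card ≤ m) with hB
  set P := B.sigma fun U => U.powerset.filter fun N => N.Nonempty with hP
  have hsub : {G : SimpleGraph (Fin n) | ¬ ComBound G m K} ⊆
      ⋃ q ∈ P, ({G | K ≤ ∑ w ∈ q.1ᶜ, 1 * ∏ u ∈ q.2, sgn G u w} ∪
        {G | K ≤ ∑ w ∈ q.1ᶜ, (-1) * ∏ u ∈ q.2, sgn G u w}) := by
    intro G hG
    by_contra hcon
    apply hG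
    refine comBound_of_star hK0 fun U hU N hN hN0 => ?_
    by_contra hlt
    refine hcon (Set.mem_biUnion (show (⟨U, N⟩ : Σ _, Finset (Fin n)) ∈ P by
        simp [hP, hB, hU, hN, hN0]) ?_)
    rcases lt_abs.1 (not_le.1 hlt) with h | h
    · left; simpa using h.le
    · right; simpa using h.le
  have hcard : (P.card : ℝ) ≤ exp (2 * L ^ 2) := by
    have h1 : P.card ≤ (2 * (n + 1)) ^ m := by
      rw [hP, Finset.card_sigma]
      calc _ ≤ ∑ U ∈ B, 2 ^ m := by
            refine Finset.sum_le_sum fun U hU => (Finset.card_filter_le _ _).trans ?_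
            rw [Finset.card_powerset]
            exact Nat.pow_le_pow_right (by norm_num) (Finset.mem_filter.1 hU).2
        _ = B.card * 2 ^ m := by simp
        _ ≤ (n + 1) ^ m * 2 ^ m := Nat.mul_le_mul_right _ card_filter_card_le
        _ = _ := by rw [mul_pow, mul_comm]
    have h2 : (P.card : ℝ) ≤ (2 * (n + 1)) ^ m := by exact_mod_cast h1
    refine h2.trans ?_
    have h3 : (2 * (n + 1) : ℝ) ≤ exp (2 * L) := by
      rw [two_mul L, exp_add, hL, exp_log hn0]; nlinarith
    calc (2 * (n + 1) : ℝ) ^ m ≤ exp (2 * L) ^ m := by gcongr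
      _ = exp (m * (2 * L)) := by rw [← exp_nat_mul]
      _ ≤ _ := by apply exp_le_exp.2; nlinarith
  calc (gnHalf n).real {G | ¬ ComBound G m K}
      ≤ _ := measureReal_mono hsub (measure_ne_top _ _)
    _ ≤ ∑ q ∈ P, _ := measureReal_biUnion_finset_le _ _
    _ ≤ ∑ q ∈ P, (exp (-(4 * L ^ 2)) + exp (-(4 * L ^ 2))) := by
        refine Finset.sum_le_sum fun q hq => ?_
        simp only [hP, hB, Finset.mem_sigma, Finset.mem_filter, Finset.mem_powerset] at hq
        refine (measureReal_union_le _ _).trans (add_le_add ?_ ?_)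
        · exact (measureReal_star_ge_le (by omega) hq.2.1 hq.2.2 (Or.inl rfl) hK0).trans
            (exp_le_exp.2 hK2)
        · exact (measureReal_star_ge_le (by omega) hq.2.1 hq.2.2 (Or.inr rfl) hK0).trans
            (exp_le_exp.2 hK2)
    _ = P.card * (2 * exp (-(4 * L ^ 2))) := by
        rw [Finset.sum_const, nsmul_eq_mul]; ring
    _ ≤ exp (2 * L ^ 2) * (2 * exp (-(4 * L ^ 2))) := by gcongr
    _ ≤ 2 * exp (-L) := by
        rw [mul_left_comm, ← exp_add]
        gcongr; nlinarith
    _ = 2 / n := by rw [exp_neg, hL, exp_log hn0]; rfl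

/-- With high probability the signed adjacency matrix and the common neighbourhoods of all small
sets are controlled. -/
lemma le_measureReal_opBound_and_comBound {n m : ℕ} (hn : 4 ≤ n) (hm : m ≤ Real.log n) :
    1 - 3 / n ≤ (gnHalf n).real {G | OpBound G (28 * (Real.sqrt n * Real.log n)) ∧
      ComBound G m (28 * (Real.sqrt n * Real.log n))} := by
  set A := {G : SimpleGraph (Fin n) | OpBound G (28 * (Real.sqrt n * Real.log n)) ∧
      ComBound G m (28 * (Real.sqrt n * Real.log n))} with hA
  have h1 : (gnHalf n).real Aᶜ ≤ 1 / n + 2 / n := by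
    refine (measureReal_mono (s₂ := {G | ¬ OpBound G (28 * (Real.sqrt n * Real.log n))} ∪
      {G | ¬ ComBound G m (28 * (Real.sqrt n * Real.log n))}) ?_ (measure_ne_top _ _)).trans
      ((measureReal_union_le _ _).trans (add_le_add (measureReal_not_opBound_le hn)
        (measureReal_not_comBound_le hn hm)))
    intro G hG
    by_contra hcon
    simp only [Set.mem_union, Set.mem_ofPred_eq, not_or, not_not] at hcon
    exact hG hcon
  have h2 : (gnHalf n).real A + (gnHalf n).real Aᶜ = 1 := by
    rw [measureReal_add_measureReal_compl (Set.toFinite A).measurableSet]; simp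
  have h3 : (3 : ℝ) / n = 1 / n + 2 / n := by ring
  linarith

/-! ### Counting clique extensions -/

open Classical in
/-- The `i`-element sets `W` outside `U` for which all pairs touching `W` inside `W ∪ U` are
edges. -/
noncomputable def cliqueExt {n : ℕ} (G : SimpleGraph (Fin n)) (U : Finset (Fin n)) (i : ℕ) :
    Finset (Finset (Fin n)) :=
  Finset.univ.filter fun W => W.card = i ∧ Disjoint W U ∧ ∀ a ∈ W, ∀ b ∈ W ∪ U, a ≠ b → G.Adj a b

/-- Double counting of pairs w ∈ W: removing w from W leaves an extension of U ∪ {w}, where w is a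
common neighbour of U. -/
lemma succ_mul_card_cliqueExt {n : ℕ} (G : SimpleGraph (Fin n)) (U : Finset (Fin n)) (i : ℕ) :
    (i + 1) * (cliqueExt G U (i + 1)).card =
      ∑ w ∈ common G U, (cliqueExt G (insert w U) i).card := by
  classical
  have h1 : (i + 1) * (cliqueExt G U (i + 1)).card = ∑ W ∈ cliqueExt G U (i + 1), W.card := by
    rw [Finset.sum_congr rfl (g := fun _ => i + 1) fun W hW => (Finset.mem_filter.1 hW).2.1]
    simp [mul_comm]
  rw [h1, ← Finset.card_sigma (cliqueExt G U (i + 1)) fun W => W, ← Finset.card_sigma]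
  refine Finset.card_bij' (fun p _ => ⟨p.2, p.1.erase p.2⟩) (fun p _ => ⟨insert p.1 p.2, p.1⟩)
    ?_ ?_ ?_ ?_
  · rintro ⟨W, w⟩ h
    simp only [Finset.mem_sigma, cliqueExt, common, Finset.mem_filter, Finset.mem_univ,
      true_and] at h ⊢
    obtain ⟨⟨hc, hd, hadj⟩, hw⟩ := h
    have hwU : w ∉ U := Finset.disjoint_left.1 hd hw
    refine ⟨⟨hwU, fun u hu => ?_⟩, ?_, ?_, ?_⟩
    · exact (hadj w hw u (Finset.mem_union_right _ hu) (by rintro rfl; exact hwU hu)).symm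
    · rw [Finset.card_erase_of_mem hw, hc]; rfl
    · rw [Finset.disjoint_insert_right]
      exact ⟨Finset.notMem_erase _ _, hd.mono_left (Finset.erase_subset _ _)⟩
    · intro a ha b hb hab
      refine hadj a (Finset.mem_of_mem_erase ha) b ?_ hab
      simp only [Finset.mem_union, Finset.mem_erase, Finset.mem_insert] at hb ⊢
      rcases hb with hb | rfl | hb
      · exact Or.inl hb.2
      · exact Or.inl hw
      · exact Or.inr hb
  · rintro ⟨w, W⟩ h
    simp only [Finset.mem_sigma, cliqueExt, common, Finset.mem_filter, Finset.mem_univ,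
      true_and] at h ⊢
    obtain ⟨⟨hwU, hw⟩, hc, hd, hadj⟩ := h
    rw [Finset.disjoint_insert_right] at hd
    refine ⟨⟨?_, ?_, ?_⟩, Finset.mem_insert_self _ _⟩
    · rw [Finset.card_insert_of_notMem hd.1, hc]
    · rw [Finset.disjoint_insert_left]; exact ⟨hwU, hd.2⟩
    · intro a ha b hb hab
      rw [Finset.mem_insert] at ha
      simp only [Finset.mem_union, Finset.mem_insert] at hb hadj
      rcases ha with rfl | ha
      · rcases hb with (rfl | hb) | hb
        · exact absurd rfl hab
        · exact (hadj b hb a (Or.inr (Or.inl rfl)) hab.symm).symm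
        · exact (hw b hb).symm
      · refine hadj a ha b ?_ hab
        tauto
  · rintro ⟨W, w⟩ h
    have hw : w ∈ W := (Finset.mem_sigma.1 h).2
    simp [Finset.insert_erase hw]
  · rintro ⟨w, W⟩ h
    simp only [Finset.mem_sigma, cliqueExt, Finset.mem_filter, Finset.disjoint_insert_right] at h
    simp [Finset.erase_insert h.2.2.2.1.1]

lemma cliqueExt_zero {n : ℕ} (G : SimpleGraph (Fin n)) (U : Finset (Fin n)) :
    cliqueExt G U 0 = {∅} := by
  ext W
  simp only [cliqueExt, Finset.mem_filter, Finset.mem_univ, true_and, Finset.card_eq_zero,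
    Finset.mem_singleton]
  constructor
  · exact fun h => h.1
  · rintro rfl; simp

/-- The expected number of clique extensions by `i` vertices of a set of size `u`. -/
noncomputable def expExt (n u i : ℕ) : ℝ :=
  ((n - u).choose i : ℝ) * (1 / 2) ^ (i * u + i.choose 2)

lemma expExt_nonneg (n u i : ℕ) : 0 ≤ expExt n u i := by unfold expExt; positivity

lemma expExt_le (n u i : ℕ) : expExt n u i ≤ (n : ℝ) ^ i := by
  unfold expExt
  calc ((n - u).choose i : ℝ) * (1 / 2) ^ (i * u + i.choose 2)
      ≤ ((n - u).choose i : ℝ) * 1 := by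
        gcongr; exact pow_le_one₀ (by norm_num) (by norm_num)
    _ ≤ (n : ℝ) ^ i := by
        rw [mul_one]
        exact_mod_cast (Nat.choose_le_pow _ _).trans (Nat.pow_le_pow_left (Nat.sub_le _ _) _)

/-- The recursion of `succ_mul_card_cliqueExt` with the number of common neighbours replaced by its
mean. -/
lemma succ_mul_expExt {n u : ℕ} (h : u < n) (i : ℕ) :
    ((i : ℝ) + 1) * expExt n u (i + 1) =
      ((n : ℝ) - u) * (1 / 2) ^ u * expExt n (u + 1) i := by
  unfold expExt
  obtain ⟨d, rfl⟩ : ∃ d, n = u + 1 + d := ⟨n - u - 1, by omega⟩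
  have h1 : u + 1 + d - u = d + 1 := by omega
  have h2 : u + 1 + d - (u + 1) = d := by omega
  have h3 : ((d : ℝ) + 1) * (d.choose i : ℝ) = ((d + 1).choose (i + 1) : ℝ) * (i + 1) := by
    exact_mod_cast Nat.add_one_mul_choose_eq d i
  have h4 : (i + 1) * u + (i + 1).choose 2 = u + (i * (u + 1) + i.choose 2) := by
    rw [Nat.choose_succ_succ' i 1, Nat.choose_one_right]; ring
  rw [h1, h2, h4, pow_add _ u]
  push_cast
  linear_combination (-(1 / 2 : ℝ) ^ u * (1 / 2 : ℝ) ^ (i * (u + 1) + i.choose 2)) * h3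

/-- Subtract the two recursions. The inductive errors contribute i K n^i and the error in the number
of common neighbours contributes K n^i; dividing by i + 1 restores the constant K. The factor n on
the left avoids a negative power at i = 0. -/
lemma abs_card_cliqueExt_sub_le {n m : ℕ} (hn : 0 < n) (hmn : m ≤ n) {G : SimpleGraph (Fin n)}
    {K : ℝ} (hC : ComBound G m K) (i : ℕ) :
    ∀ U : Finset (Fin n), U.card + i ≤ m →
      n * |((cliqueExt G U i).card : ℝ) - expExt n U.card i| ≤ K * n ^ i := by
  classical
  have hn' : (0 : ℝ) < n := by exact_mod_cast hn
  have hK : 0 ≤ K := (abs_nonneg _).trans (hC ∅ (by simp))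
  have hzero : ∀ U : Finset (Fin n), ((cliqueExt G U 0).card : ℝ) - expExt n U.card 0 = 0 := by
    intro U
    rw [cliqueExt_zero]; simp [expExt]
  induction i with
  | zero => intro U _; rw [hzero]; simpa using hK
  | succ i ih =>
    intro U hU
    -- The factor i records that the error vanishes exactly for i = 0; for i ≥ 1 this only weakens
    -- the inductive bound.
    have hi : ∀ w ∈ common G U,
        n * |((cliqueExt G (insert w U) i).card : ℝ) - expExt n (U.card + 1) i| ≤
          i * (K * n ^ i) := by
      intro w hw
      have hwU : w ∉ U := (Finset.mem_filter.1 hw).2.1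
      have hcard : (insert w U).card = U.card + 1 := Finset.card_insert_of_notMem hwU
      rcases Nat.eq_zero_or_pos i with rfl | hi
      · have := hzero (insert w U)
        rw [hcard] at this
        rw [this]; simp
      · have h1 := ih (insert w U) (by omega)
        rw [hcard] at h1
        refine h1.trans (le_mul_of_one_le_left (by positivity) ?_)
        exact_mod_cast hi
    have hrec := succ_mul_card_cliqueExt G U i
    have hrec' : ((i : ℝ) + 1) * ((cliqueExt G U (i + 1)).card : ℝ) =
      ∑ w ∈ common G U, ((cliqueExt G (insert w U) i).card : ℝ) := by exact_mod_cast hrec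
    have h1 : ((i : ℝ) + 1) * (((cliqueExt G U (i + 1)).card : ℝ) - expExt n U.card (i + 1)) =
        ∑ w ∈ common G U,
          (((cliqueExt G (insert w U) i).card : ℝ) - expExt n (U.card + 1) i) +
        (((common G U).card : ℝ) - ((n : ℝ) - U.card) * (1 / 2) ^ U.card) *
          expExt n (U.card + 1) i := by
      rw [mul_sub, hrec', succ_mul_expExt (by omega), Finset.sum_sub_distrib, Finset.sum_const,
        nsmul_eq_mul]
      ring
    have h2 : ((i : ℝ) + 1) *
        |((cliqueExt G U (i + 1)).card : ℝ) - expExt n U.card (i + 1)| ≤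
        ((i : ℝ) + 1) * (K * n ^ i) := by
      rw [← abs_of_nonneg (show (0 : ℝ) ≤ i + 1 by positivity), ← abs_mul, h1,
        abs_of_nonneg (show (0 : ℝ) ≤ i + 1 by positivity)]
      refine (abs_add_le _ _).trans ?_
      rw [add_mul, one_mul, abs_mul, abs_of_nonneg (expExt_nonneg _ _ _)]
      refine add_le_add ?_ (mul_le_mul (hC U (by omega)) (expExt_le _ _ _)
        (expExt_nonneg _ _ _) hK)
      refine (Finset.abs_sum_le_sum_abs _ _).trans ?_
      calc ∑ w ∈ common G U,
            |((cliqueExt G (insert w U) i).card : ℝ) - expExt n (U.card + 1) i|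
          ≤ ∑ w ∈ common G U, i * (K * n ^ i) / n :=
            Finset.sum_le_sum fun w hw => by rw [le_div_iff₀ hn', mul_comm]; exact hi w hw
        _ = (common G U).card * (i * (K * n ^ i) / n) := by simp
        _ ≤ n * (i * (K * n ^ i) / n) := by
            gcongr
            simpa using Finset.card_le_univ (common G U)
        _ = _ := by field_simp
    have h3 := le_of_mul_le_mul_left h2 (by positivity)
    calc n * |((cliqueExt G U (i + 1)).card : ℝ) - expExt n U.card (i + 1)|
        ≤ n * (K * n ^ i) := by gcongr
      _ = _ := by ring

/-! ### Multilinear forms in the adjacency matrix -/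

lemma OpBound.abs_le {n : ℕ} {G : SimpleGraph (Fin n)} {K : ℝ} (h : OpBound G K)
    (x y : Fin n → ℝ) : |∑ u, ∑ v, sgn G u v * x u * y v| ≤
      K * (Real.sqrt (∑ u, x u ^ 2) * Real.sqrt (∑ v, y v ^ 2)) := by
  rw [abs_le']
  refine ⟨h x y, ?_⟩
  have := h (fun u => -x u) y
  simpa using this

lemma sqrt_sum_sq_le {ι : Type*} [Fintype ι] (f g : ι → ℝ) (h : ∀ i, |f i| ≤ |g i|) :
    Real.sqrt (∑ i, f i ^ 2) ≤ Real.sqrt (∑ i, g i ^ 2) :=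
  Real.sqrt_le_sqrt (Finset.sum_le_sum fun i _ => sq_le_sq.2 (h i))

/-- Cauchy–Schwarz over the n^s choices of the frozen coordinates. -/
lemma sum_sqrt_insertNth_le {n s : ℕ} (j : Fin (s + 1)) (f : (Fin (s + 1) → Fin n) → ℝ) :
    ∑ a' : Fin s → Fin n, Real.sqrt (∑ u, f (j.insertNth u a') ^ 2) ≤
      Real.sqrt (n ^ s) * Real.sqrt (∑ a, f a ^ 2) := by
  rw [← Real.sqrt_mul (by positivity)]
  refine Real.le_sqrt_of_sq_le (sq_sum_le_card_mul_sum_sq.trans (le_of_eq ?_))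
  rw [Finset.card_univ, Fintype.card_fun, Fintype.card_fin, Fintype.card_fin]
  push_cast
  congr 1
  rw [← (Fin.insertNthEquiv (fun _ => Fin n) j).sum_comp, Fintype.sum_prod_type_right]
  refine Finset.sum_congr rfl fun a' _ => ?_
  rw [Real.sq_sqrt (Finset.sum_nonneg fun _ _ => sq_nonneg _)]
  rfl

/-- A bipartite multilinear form with one factor equal to the signed adjacency matrix gains a
factor `K / n` over the trivial bound. -/
lemma OpBound.abs_sum_mul_prod_le {n s : ℕ} {G : SimpleGraph (Fin n)} {K : ℝ}
    (hop : OpBound G K) (hK : 0 ≤ K) (h : Fin (s + 1) → Fin (s + 1) → Fin n → Fin n → ℝ)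
    (h1 : ∀ j l u v, |h j l u v| ≤ 1) (j₀ l₀ : Fin (s + 1)) (h0 : h j₀ l₀ = sgn G)
    (f g : (Fin (s + 1) → Fin n) → ℝ) :
    |∑ a, ∑ b, f a * g b * ∏ j, ∏ l, h j l (a j) (b l)| ≤
      K * n ^ s * (Real.sqrt (∑ a, f a ^ 2) * Real.sqrt (∑ b, g b ^ 2)) := by
  have hprod : ∀ {ι : Type} [Fintype ι] (c : ι → ℝ), (∀ i, |c i| ≤ 1) → |∏ i, c i| ≤ 1 := by
    intro ι _ c hc
    rw [Finset.abs_prod]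
    exact Finset.prod_le_one (fun _ _ => abs_nonneg _) fun i _ => hc i
  -- Freeze all coordinates except a_{j₀} and b_{l₀}. Factors involving only the first go into φ,
  -- those involving only the second into ψ, and the rest form the constant θ; what remains is a
  -- bilinear form in `sgn G`.
  set φ : (Fin s → Fin n) → (Fin s → Fin n) → Fin n → ℝ := fun a' b' u =>
    f (j₀.insertNth u a') * ∏ l', h j₀ (l₀.succAbove l') u (b' l') with hφ
  set ψ : (Fin s → Fin n) → (Fin s → Fin n) → Fin n → ℝ := fun a' b' v =>
    g (l₀.insertNth v b') * ∏ j', h (j₀.succAbove j') l₀ (a' j') v with hψ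
  set θ : (Fin s → Fin n) → (Fin s → Fin n) → ℝ := fun a' b' =>
    ∏ j', ∏ l', h (j₀.succAbove j') (l₀.succAbove l') (a' j') (b' l') with hθ
  have hsplit : ∑ a, ∑ b, f a * g b * ∏ j, ∏ l, h j l (a j) (b l) =
      ∑ a', ∑ b', θ a' b' * ∑ u, ∑ v, sgn G u v * φ a' b' u * ψ a' b' v := by
    rw [← (Fin.insertNthEquiv (fun _ => Fin n) j₀).sum_comp, Fintype.sum_prod_type_right]
    refine Finset.sum_congr rfl fun a' _ => ?_
    simp_rw [← (Fin.insertNthEquiv (fun _ => Fin n) l₀).sum_comp (fun b => f _ * g b * _),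
      Fintype.sum_prod_type_right, Finset.mul_sum]
    rw [Finset.sum_comm]
    refine Finset.sum_congr rfl fun b' _ => Finset.sum_congr rfl fun u _ =>
      Finset.sum_congr rfl fun v _ => ?_
    have e : ∀ j x, ∏ l, h j l x (l₀.insertNth (α := fun _ => Fin n) v b' l) =
        h j l₀ x v * ∏ l', h j (l₀.succAbove l') x (b' l') := by
      intro j x
      rw [Fin.prod_univ_succAbove _ l₀]
      simp only [Fin.insertNth_apply_same, Fin.insertNth_apply_succAbove]
    change f (j₀.insertNth u a') * g (l₀.insertNth v b') *
      ∏ j, ∏ l, h j l (j₀.insertNth (α := fun _ => Fin n) u a' j)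
        (l₀.insertNth (α := fun _ => Fin n) v b' l) = _
    simp only [e, Finset.prod_mul_distrib]
    rw [Fin.prod_univ_succAbove _ j₀, Fin.prod_univ_succAbove _ j₀]
    simp only [Fin.insertNth_apply_same, Fin.insertNth_apply_succAbove, h0, hφ, hψ, hθ]
    ring
  rw [hsplit]
  have hterm : ∀ a' b', |θ a' b' * ∑ u, ∑ v, sgn G u v * φ a' b' u * ψ a' b' v| ≤
      K * (Real.sqrt (∑ u, f (j₀.insertNth u a') ^ 2) *
        Real.sqrt (∑ v, g (l₀.insertNth v b') ^ 2)) := by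
    intro a' b'
    rw [abs_mul]
    refine (mul_le_of_le_one_left (abs_nonneg _)
      (hprod _ fun _ => hprod _ fun _ => h1 _ _ _ _)).trans ?_
    refine (hop.abs_le _ _).trans ?_
    refine mul_le_mul_of_nonneg_left (mul_le_mul (sqrt_sum_sq_le _ _ fun u => ?_)
      (sqrt_sum_sq_le _ _ fun v => ?_) (Real.sqrt_nonneg _) (Real.sqrt_nonneg _)) hK
    · simp only [hφ, abs_mul]
      exact mul_le_of_le_one_right (abs_nonneg _) (hprod _ fun _ => h1 _ _ _ _)
    · simp only [hψ, abs_mul]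
      exact mul_le_of_le_one_right (abs_nonneg _) (hprod _ fun _ => h1 _ _ _ _)
  calc _ ≤ ∑ a', ∑ b', K * (Real.sqrt (∑ u, f (j₀.insertNth u a') ^ 2) *
        Real.sqrt (∑ v, g (l₀.insertNth v b') ^ 2)) := by
        refine (Finset.abs_sum_le_sum_abs _ _).trans (Finset.sum_le_sum fun a' _ => ?_)
        exact (Finset.abs_sum_le_sum_abs _ _).trans (Finset.sum_le_sum fun b' _ => hterm a' b')
    _ = K * ((∑ a' : Fin s → Fin n, Real.sqrt (∑ u, f (j₀.insertNth u a') ^ 2)) *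
        ∑ b' : Fin s → Fin n, Real.sqrt (∑ v, g (l₀.insertNth v b') ^ 2)) := by
        rw [Finset.sum_mul_sum, Finset.mul_sum]
        simp_rw [Finset.mul_sum]
    _ ≤ K * ((Real.sqrt (n ^ s) * Real.sqrt (∑ a, f a ^ 2)) *
        (Real.sqrt (n ^ s) * Real.sqrt (∑ b, g b ^ 2))) := by
        gcongr
        · exact sum_sqrt_insertNth_le _ _
        · exact sum_sqrt_insertNth_le _ _
    _ = _ := by
        have : Real.sqrt ((n : ℝ) ^ s) * Real.sqrt (n ^ s) = n ^ s :=
          Real.mul_self_sqrt (by positivity)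
        linear_combination (K * Real.sqrt (∑ a, f a ^ 2) * Real.sqrt (∑ b, g b ^ 2)) * this

/-- The indicator of `u ≠ v`. -/
noncomputable def neInd {n : ℕ} (u v : Fin n) : ℝ := if u = v then 0 else 1

open Classical in
/-- The indicator of `u` and `v` being adjacent. -/
noncomputable def adjInd {n : ℕ} (G : SimpleGraph (Fin n)) (u v : Fin n) : ℝ :=
  if G.Adj u v then 1 else 0

lemma adjInd_eq {n : ℕ} (G : SimpleGraph (Fin n)) (u v : Fin n) :
    adjInd G u v = (1 / 2) * sgn G u v + (1 / 2) * neInd u v := by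
  unfold adjInd neInd
  rcases eq_or_ne u v with rfl | h
  · simp [sgn_self]
  · rw [ite_adj_eq G h, if_neg h]; ring

/-- Expand over the set F of positions where the sign is chosen instead of the mean. F = ∅ is the
subtracted term, every other F contains a sign factor, and the number of terms is paid for by the
prefactor 2^(-s²). -/
lemma OpBound.abs_sum_adjInd_sub_le {n s : ℕ} {G : SimpleGraph (Fin n)} {K : ℝ}
    (hop : OpBound G K) (hK : 0 ≤ K) (f g : (Fin s → Fin n) → ℝ) :
    n * |∑ a, ∑ b, f a * g b * (∏ j, ∏ l, adjInd G (a j) (b l) -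
        (1 / 2) ^ (s * s) * ∏ j, ∏ l, neInd (a j) (b l))| ≤
      K * n ^ s * (Real.sqrt (∑ a, f a ^ 2) * Real.sqrt (∑ b, g b ^ 2)) := by
  classical
  cases s with
  | zero => simp; positivity
  | succ s =>
  set h : Finset (Fin (s + 1) × Fin (s + 1)) → Fin (s + 1) → Fin (s + 1) → Fin n → Fin n → ℝ :=
    fun F j l => if (j, l) ∈ F then sgn G else neInd with hh
  have hle : ∀ F j l u v, |h F j l u v| ≤ 1 := by
    intro F j l u v
    simp only [hh]
    split_ifs
    · exact abs_sgn_le _ _ _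
    · unfold neInd; split_ifs <;> simp
  have hexp : ∀ a b : Fin (s + 1) → Fin n, ∏ j, ∏ l, adjInd G (a j) (b l) -
      (1 / 2) ^ ((s + 1) * (s + 1)) * ∏ j, ∏ l, neInd (a j) (b l) =
      (1 / 2) ^ ((s + 1) * (s + 1)) * ∑ F ∈ Finset.univ.erase ∅,
        ∏ j, ∏ l, h F j l (a j) (b l) := by
    intro a b
    have h1 : ∏ j, ∏ l, adjInd G (a j) (b l) = (1 / 2) ^ ((s + 1) * (s + 1)) *
        ∑ F, ∏ j, ∏ l, h F j l (a j) (b l) := by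
      simp_rw [← Fintype.prod_prod_type', adjInd_eq, ← mul_add, Finset.prod_mul_distrib]
      rw [Finset.prod_const, Finset.card_univ, Fintype.card_prod, Fintype.card_fin,
        Finset.prod_add, Finset.powerset_univ]
      congr 1
      refine Finset.sum_congr rfl fun F _ => ?_
      rw [← Finset.prod_mul_prod_compl F, Finset.compl_eq_univ_sdiff]
      congr 1
      · refine Finset.prod_congr rfl fun p hp => ?_
        simp [hh, hp]
      · refine Finset.prod_congr rfl fun p hp => ?_
        rw [Finset.mem_sdiff] at hp
        simp [hh, hp.2]
    rw [h1, ← Finset.add_sum_erase Finset.univ _ (Finset.mem_univ ∅), mul_add]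
    simp [hh]
  have hF : ∀ F ∈ (Finset.univ : Finset (Finset (Fin (s + 1) × Fin (s + 1)))).erase ∅,
      |∑ a, ∑ b, f a * g b * ∏ j, ∏ l, h F j l (a j) (b l)| ≤
      K * n ^ s * (Real.sqrt (∑ a, f a ^ 2) * Real.sqrt (∑ b, g b ^ 2)) := by
    intro F hF
    obtain ⟨⟨j₀, l₀⟩, hp⟩ := Finset.nonempty_iff_ne_empty.2 (Finset.ne_of_mem_erase hF)
    exact hop.abs_sum_mul_prod_le hK (h F) (hle F) j₀ l₀ (by simp [hh, hp]) f g
  have hsum : ∑ a, ∑ b, f a * g b * (∏ j, ∏ l, adjInd G (a j) (b l) -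
        (1 / 2) ^ ((s + 1) * (s + 1)) * ∏ j, ∏ l, neInd (a j) (b l)) =
      (1 / 2) ^ ((s + 1) * (s + 1)) * ∑ F ∈ Finset.univ.erase ∅,
        ∑ a, ∑ b, f a * g b * ∏ j, ∏ l, h F j l (a j) (b l) := by
    simp_rw [hexp]
    rw [Finset.sum_comm (s := Finset.univ.erase ∅), Finset.mul_sum]
    refine Finset.sum_congr rfl fun a _ => ?_
    rw [Finset.sum_comm (s := Finset.univ.erase ∅), Finset.mul_sum]
    refine Finset.sum_congr rfl fun b _ => ?_
    rw [← Finset.mul_sum]; ring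
  set Q := K * n ^ s * (Real.sqrt (∑ a, f a ^ 2) * Real.sqrt (∑ b, g b ^ 2)) with hQ
  have hQ0 : 0 ≤ Q := by positivity
  rw [hsum, abs_mul, abs_of_nonneg (by positivity)]
  calc (n : ℝ) * ((1 / 2) ^ ((s + 1) * (s + 1)) * |∑ F ∈ Finset.univ.erase ∅,
        ∑ a, ∑ b, f a * g b * ∏ j, ∏ l, h F j l (a j) (b l)|)
      ≤ n * ((1 / 2) ^ ((s + 1) * (s + 1)) * (2 ^ ((s + 1) * (s + 1)) * Q)) := by
        gcongr
        refine (Finset.abs_sum_le_sum_abs _ _).trans ((Finset.sum_le_sum hF).trans ?_)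
        rw [Finset.sum_const, nsmul_eq_mul]
        gcongr
        refine (Nat.cast_le.2 (Finset.card_le_card (Finset.erase_subset _ _))).trans ?_
        simp
    _ = n * Q := by rw [← mul_assoc (_ ^ _), ← mul_pow]; norm_num
    _ = _ := by rw [hQ]; ring

/-! ### Factorization of the matrix entries -/

lemma mem_pairs {n : ℕ} {S : Finset (Fin n)} {a b : Fin n} :
    s(a, b) ∈ pairs S ↔ a ∈ S ∧ b ∈ S ∧ a ≠ b := by
  constructor
  · rintro ⟨i, hi, j, hj, hij, h⟩
    rw [Sym2.eq_iff] at h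
    rcases h with ⟨rfl, rfl⟩ | ⟨rfl, rfl⟩
    · exact ⟨hi, hj, hij⟩
    · exact ⟨hj, hi, hij.symm⟩
  · exact fun ⟨ha, hb, hab⟩ => ⟨a, ha, b, hb, hab, rfl⟩

lemma pairs_sdiff_subset_iff {n : ℕ} {G : SimpleGraph (Fin n)} {T I J : Finset (Fin n)} :
    pairs T \ (pairs I ∪ pairs J) ⊆ G.edgeSet ↔
      ∀ a ∈ T, ∀ b ∈ T, a ≠ b → ¬ (a ∈ I ∧ b ∈ I) → ¬ (a ∈ J ∧ b ∈ J) → G.Adj a b := by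
  constructor
  · intro h a ha b hb hab hI hJ
    refine G.mem_edgeSet.1 (h ⟨mem_pairs.2 ⟨ha, hb, hab⟩, ?_⟩)
    rintro (h' | h') <;> rw [mem_pairs] at h'
    · exact hI ⟨h'.1, h'.2.1⟩
    · exact hJ ⟨h'.1, h'.2.1⟩
  · rintro h e ⟨⟨a, ha, b, hb, hab, rfl⟩, h2⟩
    rw [Set.mem_union, mem_pairs, mem_pairs, not_or] at h2
    exact h a ha b hb hab (fun h' => h2.1 ⟨h'.1, h'.2, hab⟩) (fun h' => h2.2 ⟨h'.1, h'.2, hab⟩)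

/-- The indicator that all pairs between `A` and `B` are edges. -/
noncomputable def cross {n : ℕ} (G : SimpleGraph (Fin n)) (A B : Finset (Fin n)) : ℝ :=
  ∏ a ∈ A, ∏ b ∈ B, adjInd G a b

open Classical in
lemma cross_eq {n : ℕ} (G : SimpleGraph (Fin n)) (A B : Finset (Fin n)) :
    cross G A B = if ∀ a ∈ A, ∀ b ∈ B, G.Adj a b then 1 else 0 := by
  unfold cross adjInd
  simp_rw [Finset.prod_ite_zero, Finset.prod_const_one]
  rw [Finset.prod_ite_zero, Finset.prod_const_one]
  split_ifs <;> rfl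

lemma cross_nonneg {n : ℕ} (G : SimpleGraph (Fin n)) (A B : Finset (Fin n)) :
    0 ≤ cross G A B := by
  classical
  rw [cross_eq]; split_ifs <;> norm_num

lemma cross_le_one {n : ℕ} (G : SimpleGraph (Fin n)) (A B : Finset (Fin n)) :
    cross G A B ≤ 1 := by
  classical
  rw [cross_eq]; split_ifs <;> norm_num

lemma card_union_add_card_inter {n r : ℕ} (I J : Sub n r) :
    (I.1 ∪ J.1).card + (I.1 ∩ J.1).card = 2 * r := by
  rw [Finset.card_union_add_card_inter, I.2, J.2]; ring

-- Write T = W ∪ (I ∪ J), so |W| = |I ∩ J|. A pair in T contained in neither I nor J either joins I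
-- \ J to J \ I or meets W; the first kind is governed by `cross`, the second by `cliqueExt`.
open Classical in
lemma card_filter_eq_cross_mul {n r : ℕ} (G : SimpleGraph (Fin n)) (I J : Sub n r) :
    (((Finset.powersetCard (2 * r) (Finset.univ : Finset (Fin n))).filter fun T =>
      I.1 ∪ J.1 ⊆ T ∧ pairs T \ (pairs I.1 ∪ pairs J.1) ⊆ G.edgeSet).card : ℝ) =
      cross G (I.1 \ J.1) (J.1 \ I.1) * (cliqueExt G (I.1 ∪ J.1) (I.1 ∩ J.1).card).card := by
  have hcard := card_union_add_card_inter I J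
  rw [cross_eq]
  split_ifs with hc
  · rw [one_mul, Nat.cast_inj]
    refine Finset.card_bij' (fun T _ => T \ (I.1 ∪ J.1)) (fun W _ => W ∪ (I.1 ∪ J.1)) ?_ ?_ ?_ ?_
    · intro T hT
      simp only [Finset.mem_filter, Finset.mem_powersetCard_univ, pairs_sdiff_subset_iff] at hT
      obtain ⟨hT1, hT2, hT3⟩ := hT
      simp only [cliqueExt, Finset.mem_filter, Finset.mem_univ, true_and]
      refine ⟨?_, Finset.sdiff_disjoint, ?_⟩
      · rw [Finset.card_sdiff_of_subset hT2]; omega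
      · intro a ha b hb hab
        rw [Finset.sdiff_union_of_subset hT2] at hb
        rw [Finset.mem_sdiff, Finset.mem_union, not_or] at ha
        exact hT3 a ha.1 b hb hab (fun h => ha.2.1 h.1) (fun h => ha.2.2 h.1)
    · intro W hW
      simp only [cliqueExt, Finset.mem_filter, Finset.mem_univ, true_and] at hW
      obtain ⟨hW1, hW2, hW3⟩ := hW
      simp only [Finset.mem_filter, Finset.mem_powersetCard_univ, pairs_sdiff_subset_iff]
      refine ⟨?_, Finset.subset_union_right, ?_⟩
      · rw [Finset.card_union_of_disjoint hW2]; omega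
      · intro a ha b hb hab hI hJ
        by_cases haW : a ∈ W
        · exact hW3 a haW b hb hab
        by_cases hbW : b ∈ W
        · exact (hW3 b hbW a ha hab.symm).symm
        have ha' : a ∈ I.1 ∨ a ∈ J.1 := by simpa [haW] using ha
        have hb' : b ∈ I.1 ∨ b ∈ J.1 := by simpa [hbW] using hb
        by_cases haI : a ∈ I.1
        · have hbI : b ∉ I.1 := fun h => hI ⟨haI, h⟩
          have hbJ : b ∈ J.1 := hb'.resolve_left hbI
          have haJ : a ∉ J.1 := fun h => hJ ⟨h, hbJ⟩
          exact hc a (Finset.mem_sdiff.2 ⟨haI, haJ⟩) b (Finset.mem_sdiff.2 ⟨hbJ, hbI⟩)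
        · have haJ : a ∈ J.1 := ha'.resolve_left haI
          have hbJ : b ∉ J.1 := fun h => hJ ⟨haJ, h⟩
          have hbI : b ∈ I.1 := hb'.resolve_right hbJ
          exact (hc b (Finset.mem_sdiff.2 ⟨hbI, hbJ⟩) a (Finset.mem_sdiff.2 ⟨haJ, haI⟩)).symm
    · intro T hT
      exact Finset.sdiff_union_of_subset (Finset.mem_filter.1 hT).2.1
    · intro W hW
      exact Finset.union_sdiff_cancel_right (Finset.mem_filter.1 hW).2.2.1
  · rw [zero_mul, Nat.cast_eq_zero, Finset.card_eq_zero, Finset.filter_eq_empty_iff]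
    rintro T - ⟨hT2, hT3⟩
    rw [pairs_sdiff_subset_iff] at hT3
    refine hc fun a ha b hb => ?_
    rw [Finset.mem_sdiff] at ha hb
    exact hT3 a (hT2 (Finset.mem_union_left _ ha.1)) b (hT2 (Finset.mem_union_right _ hb.1))
      (by rintro rfl; exact ha.2 hb.1) (fun h => hb.2 h.2) (fun h => ha.2 h.1)

lemma filledMatrix_apply {n r : ℕ} (G : SimpleGraph (Fin n)) (k : ℕ) (I J : Sub n r) :
    filledMatrix G k r I J = coeff k r (I.1 ∩ J.1).card *
      (cross G (I.1 \ J.1) (J.1 \ I.1) *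
        (cliqueExt G (I.1 ∪ J.1) (I.1 ∩ J.1).card).card) := by
  classical
  rw [← card_filter_eq_cross_mul, filledMatrix, Matrix.sum_apply]
  simp only [matrixOn, Matrix.of_apply]
  rw [← Finset.sum_filter, Finset.sum_const, nsmul_eq_mul, mul_comm]

lemma filledMatrix_isHermitian {n r : ℕ} (G : SimpleGraph (Fin n)) (k : ℕ) :
    (filledMatrix G k r).IsHermitian := by
  ext I J
  rw [Matrix.conjTranspose_apply, star_trivial]
  simp only [filledMatrix, Matrix.sum_apply, matrixOn, Matrix.of_apply]
  refine Finset.sum_congr rfl fun T _ => ?_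
  rw [Finset.union_comm, Set.union_comm, Finset.inter_comm]

lemma filledMatrix_posDef_of_forall {n r k : ℕ} {G : SimpleGraph (Fin n)}
    (h : ∀ x : Sub n r → ℝ, x ≠ 0 → 0 < ∑ I, ∑ J, x I * x J * filledMatrix G k r I J) :
    (filledMatrix G k r).PosDef := by
  refine Matrix.PosDef.of_dotProduct_mulVec_pos (filledMatrix_isHermitian G k) fun x hx => ?_
  have e : star x ⬝ᵥ (filledMatrix G k r).mulVec x =
      ∑ I, ∑ J, x I * x J * filledMatrix G k r I J := by
    simp only [dotProduct, Matrix.mulVec, Finset.mul_sum, Pi.star_apply, star_trivial]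
    exact Finset.sum_congr rfl fun I _ => Finset.sum_congr rfl fun J _ => by ring
  rw [e]; exact h x hx

/-! ### Grouping pairs of r-sets by their intersection -/

section Fiber

variable {n r : ℕ}

/-- The `r`-sets containing `Y`. -/
abbrev Above (n r : ℕ) (Y : Finset (Fin n)) : Type := {I : Sub n r // Y ⊆ I.1}

lemma Above.card_sdiff {Y : Finset (Fin n)} (I : Above n r Y) :
    (I.1.1 \ Y).card = r - Y.card := by
  rw [Finset.card_sdiff_of_subset I.2, I.1.2]

/-- The increasing enumeration of `I \ Y`. -/
noncomputable def Above.enum {Y : Finset (Fin n)} (I : Above n r Y) :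
    Fin (r - Y.card) → Fin n :=
  (I.1.1 \ Y).orderEmbOfFin I.card_sdiff

lemma Above.image_enum {Y : Finset (Fin n)} (I : Above n r Y) :
    Finset.univ.image I.enum = I.1.1 \ Y :=
  Finset.image_orderEmbOfFin_univ _ _

lemma Above.enum_injective {Y : Finset (Fin n)} :
    Function.Injective (Above.enum : Above n r Y → _) := by
  intro I J h
  have h1 : I.1.1 \ Y = J.1.1 \ Y := by rw [← I.image_enum, ← J.image_enum, h]
  apply Subtype.ext; apply Subtype.ext
  rw [← Finset.sdiff_union_of_subset I.2, ← Finset.sdiff_union_of_subset J.2, h1]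

lemma Above.prod_enum {Y : Finset (Fin n)} (I : Above n r Y) (F : Fin n → ℝ) :
    ∏ j, F (I.enum j) = ∏ a ∈ I.1.1 \ Y, F a := by
  rw [← I.image_enum, Finset.prod_image]
  exact fun a _ b _ h => (Finset.orderEmbOfFin _ I.card_sdiff).injective h

lemma Above.card_le (Y : Finset (Fin n)) :
    Fintype.card (Above n r Y) ≤ n ^ (r - Y.card) := by
  simpa using Fintype.card_le_of_injective _ (Above.enum_injective (r := r) (Y := Y))

lemma Above.sum_eq (Y : Finset (Fin n)) (F : Sub n r → ℝ) :
    ∑ I : Above n r Y, F I.1 = ∑ I : Sub n r, if Y ⊆ I.1 then F I else 0 := by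
  rw [← Finset.sum_filter]
  exact (Finset.sum_subtype _ (by simp) F).symm

/-- Reindexing of a sum over pairs of `r`-sets by their intersection. -/
lemma sum_sum_eq_sum_above (F : Sub n r → Sub n r → ℝ) :
    ∑ I, ∑ J, F I J = ∑ Y : Finset (Fin n), ∑ I : Above n r Y, ∑ J : Above n r Y,
      if I.1.1 ∩ J.1.1 = Y then F I.1 J.1 else 0 := by
  have h : ∀ Y : Finset (Fin n), ∑ I : Above n r Y, ∑ J : Above n r Y,
      (if I.1.1 ∩ J.1.1 = Y then F I.1 J.1 else 0) =
      ∑ I : Sub n r, ∑ J : Sub n r, if I.1 ∩ J.1 = Y then F I J else 0 := by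
    intro Y
    rw [Above.sum_eq Y fun I => ∑ J : Above n r Y, if I.1 ∩ J.1.1 = Y then F I J.1 else 0]
    refine Finset.sum_congr rfl fun I _ => ?_
    rw [Above.sum_eq Y fun J => if I.1 ∩ J.1 = Y then F I J else 0]
    split_ifs with hI
    · refine Finset.sum_congr rfl fun J _ => ?_
      split_ifs with hJ hIJ hIJ
      · rfl
      · rfl
      · exact absurd (hIJ ▸ Finset.inter_subset_right) hJ
      · rfl
    · refine (Finset.sum_eq_zero fun J _ => if_neg ?_).symm
      rintro rfl
      exact hI Finset.inter_subset_left
  simp_rw [h]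
  symm
  rw [Finset.sum_comm]
  refine Finset.sum_congr rfl fun I _ => ?_
  rw [Finset.sum_comm]
  refine Finset.sum_congr rfl fun J _ => ?_
  simp

/-- Each I is counted once for every Y ⊆ I, and binom(r, i) of these have size i. -/
lemma sum_above_sq_eq (w : ℕ → ℝ) (x : Sub n r → ℝ) :
    ∑ Y : Finset (Fin n), w Y.card * ∑ I : Above n r Y, x I.1 ^ 2 =
      (∑ i ∈ Finset.range (r + 1), (r.choose i : ℝ) * w i) * ∑ I, x I ^ 2 := by
  simp_rw [Above.sum_eq _ fun I => x I ^ 2, Finset.mul_sum]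
  rw [Finset.sum_comm]
  refine Finset.sum_congr rfl fun I _ => ?_
  have h1 : ∑ Y : Finset (Fin n), w Y.card * (if Y ⊆ I.1 then x I ^ 2 else 0) =
      (∑ Y ∈ I.1.powerset, w Y.card) * x I ^ 2 := by
    rw [Finset.sum_mul, ← Finset.sum_filter_add_sum_filter_not Finset.univ (fun Y => Y ⊆ I.1)]
    rw [Finset.sum_eq_zero (s := Finset.univ.filter fun Y => ¬ Y ⊆ I.1), add_zero]
    · refine Finset.sum_congr (by ext; simp) fun Y hY => ?_
      rw [if_pos (Finset.mem_powerset.1 hY)]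
    · intro Y hY
      rw [if_neg (Finset.mem_filter.1 hY).2, mul_zero]
  rw [h1, Finset.sum_powerset_apply_card (fun i => w i), I.2]
  simp

end Fiber

/-! ### Fluctuation around the mean matrix -/

section Deviation

variable {n r : ℕ} {G : SimpleGraph (Fin n)} {K : ℝ}

/-- Extend x by zero along the injection e to a function on all s-tuples. -/
lemma OpBound.abs_sum_injective_le {s : ℕ} (hop : OpBound G K) (hK : 0 ≤ K) {ι : Type*}
    [Fintype ι] (e : ι → Fin s → Fin n) (he : Function.Injective e) (x : ι → ℝ) :
    n * |∑ I, ∑ J, x I * x J * (∏ j, ∏ l, adjInd G (e I j) (e J l) -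
        (1 / 2) ^ (s * s) * ∏ j, ∏ l, neInd (e I j) (e J l))| ≤
      K * n ^ s * ∑ I, x I ^ 2 := by
  classical
  set f : (Fin s → Fin n) → ℝ := Function.extend e x 0 with hf
  have hfe : ∀ I, f (e I) = x I := fun I => he.extend_apply x 0 I
  have hf0 : ∀ a ∉ Set.range e, f a = 0 := fun a ha => by
    rw [hf, Function.extend_apply' _ _ _ ha]; rfl
  have h := hop.abs_sum_adjInd_sub_le hK f f
  have h2 : ∑ I, x I ^ 2 = ∑ a, f a ^ 2 :=
    Fintype.sum_of_injective e he _ _ (fun a ha => by simp [hf0 a ha]) fun I => by rw [hfe]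
  rw [Real.mul_self_sqrt (Finset.sum_nonneg fun _ _ => sq_nonneg _), ← h2] at h
  convert h using 3
  refine Fintype.sum_of_injective e he _ _ (fun a ha => by simp [hf0 a ha]) fun I => ?_
  refine Fintype.sum_of_injective e he _ _ (fun a ha => by simp [hf0 a ha]) fun J => ?_
  rw [hfe, hfe]

/-- A common element of I and J outside Y contributes a factor h v v = 0. The product therefore
enforces I ∩ J = Y by itself, and the constrained sum becomes an unrestricted bilinear form. -/
lemma prod_prod_sdiff_eq {h : Fin n → Fin n → ℝ} (h0 : ∀ u, h u u = 0) {Y : Finset (Fin n)}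
    (I J : Above n r Y) :
    ∏ j, ∏ l, h (I.enum j) (J.enum l) =
      if I.1.1 ∩ J.1.1 = Y then ∏ a ∈ I.1.1 \ J.1.1, ∏ b ∈ J.1.1 \ I.1.1, h a b else 0 := by
  simp_rw [J.prod_enum]
  rw [I.prod_enum fun a => ∏ b ∈ J.1.1 \ Y, h a b]
  split_ifs with hY
  · have h1 : I.1.1 \ Y = I.1.1 \ J.1.1 :=
      (congrArg (I.1.1 \ ·) hY).symm.trans (Finset.sdiff_inter_self_left _ _)
    have h2 : J.1.1 \ Y = J.1.1 \ I.1.1 :=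
      (congrArg (J.1.1 \ ·) hY).symm.trans (Finset.sdiff_inter_self_right _ _)
    rw [h1, h2]
  · obtain ⟨v, hv, hvY⟩ := Finset.exists_of_ssubset
      (Finset.ssubset_iff_subset_ne.2 ⟨Finset.subset_inter I.2 J.2, Ne.symm hY⟩)
    rw [Finset.mem_inter] at hv
    exact Finset.prod_eq_zero (Finset.mem_sdiff.2 ⟨hv.1, hvY⟩)
      (Finset.prod_eq_zero (Finset.mem_sdiff.2 ⟨hv.2, hvY⟩) (h0 v))

/-- The fluctuation of the bipartite part, for a fixed intersection `Y`. -/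
lemma OpBound.abs_sum_cross_sub_le (hop : OpBound G K) (hK : 0 ≤ K) (Y : Finset (Fin n))
    (x : Sub n r → ℝ) :
    n * |∑ I : Above n r Y, ∑ J : Above n r Y, if I.1.1 ∩ J.1.1 = Y then
        x I.1 * x J.1 * (cross G (I.1.1 \ J.1.1) (J.1.1 \ I.1.1) -
          (1 / 2) ^ ((r - Y.card) * (r - Y.card))) else 0| ≤
      K * n ^ (r - Y.card) * ∑ I : Above n r Y, x I.1 ^ 2 := by
  have h := hop.abs_sum_injective_le hK _ (Above.enum_injective (r := r) (Y := Y))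
    (fun I => x I.1)
  convert h using 3
  refine Finset.sum_congr rfl fun I _ => Finset.sum_congr rfl fun J _ => ?_
  rw [prod_prod_sdiff_eq (h := adjInd G) (by simp [adjInd]),
    prod_prod_sdiff_eq (h := neInd) (by simp [neInd])]
  split_ifs
  · rw [Finset.prod_eq_one (s := I.1.1 \ J.1.1) (f := fun a => ∏ b ∈ J.1.1 \ I.1.1, neInd a b),
      mul_one]
    · rfl
    · intro a ha
      refine Finset.prod_eq_one fun b hb => ?_
      rw [neInd, if_neg]
      rintro rfl
      exact (Finset.mem_sdiff.1 ha).2 (Finset.mem_sdiff.1 hb).1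
  · simp

/-- The fluctuation of the number of extensions, for a fixed intersection `Y`. -/
lemma ComBound.abs_sum_cliqueExt_sub_le (hn : 0 < n) (hrn : 2 * r ≤ n)
    (hC : ComBound G (2 * r) K) {Y : Finset (Fin n)} (hY : Y.card ≤ r) (x : Sub n r → ℝ) :
    n * |∑ I : Above n r Y, ∑ J : Above n r Y, if I.1.1 ∩ J.1.1 = Y then
        x I.1 * x J.1 * (cross G (I.1.1 \ J.1.1) (J.1.1 \ I.1.1) *
          ((cliqueExt G (I.1.1 ∪ J.1.1) Y.card).card - expExt n (2 * r - Y.card) Y.card)) else 0| ≤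
      K * n ^ r * ∑ I : Above n r Y, x I.1 ^ 2 := by
  have hn' : (0 : ℝ) < n := by exact_mod_cast hn
  have hK : 0 ≤ K := (abs_nonneg _).trans (hC ∅ (by simp))
  have hterm : ∀ I J : Above n r Y, |if I.1.1 ∩ J.1.1 = Y then
        x I.1 * x J.1 * (cross G (I.1.1 \ J.1.1) (J.1.1 \ I.1.1) *
          ((cliqueExt G (I.1.1 ∪ J.1.1) Y.card).card - expExt n (2 * r - Y.card) Y.card)) else 0| ≤
      |x I.1| * |x J.1| * (K * n ^ Y.card / n) := by
    intro I J
    split_ifs with hIJ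
    · have hcard := card_union_add_card_inter I.1 J.1
      rw [hIJ] at hcard
      have hu : (I.1.1 ∪ J.1.1).card = 2 * r - Y.card := by omega
      have h1 := abs_card_cliqueExt_sub_le hn hrn hC Y.card (I.1.1 ∪ J.1.1) (by omega)
      rw [hu] at h1
      rw [abs_mul, abs_mul, abs_mul, abs_of_nonneg (cross_nonneg _ _ _)]
      gcongr
      rw [le_div_iff₀ hn']
      calc _ ≤ 1 * |((cliqueExt G (I.1.1 ∪ J.1.1) Y.card).card : ℝ) -
            expExt n (2 * r - Y.card) Y.card| * n := by
            gcongr; exact cross_le_one _ _ _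
        _ ≤ _ := by rw [one_mul, mul_comm]; exact h1
    · rw [abs_zero]; positivity
  have hsum : |∑ I : Above n r Y, ∑ J : Above n r Y, if I.1.1 ∩ J.1.1 = Y then
        x I.1 * x J.1 * (cross G (I.1.1 \ J.1.1) (J.1.1 \ I.1.1) *
          ((cliqueExt G (I.1.1 ∪ J.1.1) Y.card).card - expExt n (2 * r - Y.card) Y.card)) else 0| ≤
      (∑ I : Above n r Y, |x I.1|) ^ 2 * (K * n ^ Y.card / n) := by
    rw [sq, Finset.sum_mul_sum, Finset.sum_mul]
    simp_rw [Finset.sum_mul]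
    exact (Finset.abs_sum_le_sum_abs _ _).trans (Finset.sum_le_sum fun I _ =>
      (Finset.abs_sum_le_sum_abs _ _).trans (Finset.sum_le_sum fun J _ => hterm I J))
  -- At most n^(r-|Y|) sets lie above Y; together with the error n^|Y| of the extension count this
  -- gives n^r, whatever the size of Y.
  have hcs : (∑ I : Above n r Y, |x I.1|) ^ 2 ≤
      n ^ (r - Y.card) * ∑ I : Above n r Y, x I.1 ^ 2 := by
    refine sq_sum_le_card_mul_sum_sq.trans ?_
    simp_rw [sq_abs]
    gcongr
    rw [Finset.card_univ]; exact_mod_cast Above.card_le Y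
  calc _ ≤ n * ((n ^ (r - Y.card) * ∑ I : Above n r Y, x I.1 ^ 2) * (K * n ^ Y.card / n)) := by
        gcongr; exact hsum.trans (by gcongr)
    _ = K * (n ^ (r - Y.card) * n ^ Y.card) * ∑ I : Above n r Y, x I.1 ^ 2 := by
        field_simp
    _ = _ := by rw [← pow_add, Nat.sub_add_cancel hY]

lemma coeff_nonneg (k r i : ℕ) : 0 ≤ coeff k r i := by unfold coeff; positivity

/-- The expectation of the entry of `filledMatrix` at `(I, J)` when `|I ∩ J| = i`. -/
noncomputable def meanEntry (n k r i : ℕ) : ℝ :=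
  coeff k r i * (expExt n (2 * r - i) i * (1 / 2) ^ ((r - i) * (r - i)))

/-- The quadratic form of `filledMatrix` differs little from that of its expectation. -/
lemma abs_sum_filledMatrix_sub_le (hn : 0 < n) (hrn : 2 * r ≤ n) (hop : OpBound G K)
    (hC : ComBound G (2 * r) K) (k : ℕ) (x : Sub n r → ℝ) :
    n * |∑ I, ∑ J, x I * x J *
        (filledMatrix G k r I J - meanEntry n k r (I.1 ∩ J.1).card)| ≤
      2 * K * n ^ r * (∑ i ∈ Finset.range (r + 1), (r.choose i : ℝ) * coeff k r i) *
        ∑ I, x I ^ 2 := by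
  have hK : 0 ≤ K := (abs_nonneg _).trans (hC ∅ (by simp))
  rw [sum_sum_eq_sum_above]
  have hY : ∀ Y : Finset (Fin n),
      n * |∑ I : Above n r Y, ∑ J : Above n r Y, if I.1.1 ∩ J.1.1 = Y then
        x I.1 * x J.1 * (filledMatrix G k r I.1 J.1 - meanEntry n k r (I.1.1 ∩ J.1.1).card)
          else 0| ≤
      2 * K * n ^ r * (coeff k r Y.card * ∑ I : Above n r Y, x I.1 ^ 2) := by
    intro Y
    have hS : 0 ≤ ∑ I : Above n r Y, x I.1 ^ 2 := Finset.sum_nonneg fun _ _ => sq_nonneg _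
    by_cases hYr : Y.card ≤ r
    swap
    · have : IsEmpty (Above n r Y) :=
        ⟨fun I => hYr ((Finset.card_le_card I.2).trans I.1.2.le)⟩
      simp
    set A := ∑ I : Above n r Y, ∑ J : Above n r Y, if I.1.1 ∩ J.1.1 = Y then
        x I.1 * x J.1 * (cross G (I.1.1 \ J.1.1) (J.1.1 \ I.1.1) *
          ((cliqueExt G (I.1.1 ∪ J.1.1) Y.card).card - expExt n (2 * r - Y.card) Y.card)) else 0
      with hA
    set B := ∑ I : Above n r Y, ∑ J : Above n r Y, if I.1.1 ∩ J.1.1 = Y then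
        x I.1 * x J.1 * (cross G (I.1.1 \ J.1.1) (J.1.1 \ I.1.1) -
          (1 / 2) ^ ((r - Y.card) * (r - Y.card))) else 0 with hB
    -- Splitting: cross · count − mean = cross · (count − `expExt`) + `expExt` · (cross − its mean).
    have hAB : ∑ I : Above n r Y, ∑ J : Above n r Y, (if I.1.1 ∩ J.1.1 = Y then
        x I.1 * x J.1 * (filledMatrix G k r I.1 J.1 - meanEntry n k r (I.1.1 ∩ J.1.1).card)
          else 0) = coeff k r Y.card * (A + expExt n (2 * r - Y.card) Y.card * B) := by
      rw [hA, hB, Finset.mul_sum, ← Finset.sum_add_distrib, Finset.mul_sum]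
      refine Finset.sum_congr rfl fun I _ => ?_
      rw [Finset.mul_sum, ← Finset.sum_add_distrib, Finset.mul_sum]
      refine Finset.sum_congr rfl fun J _ => ?_
      split_ifs with hIJ
      · rw [filledMatrix_apply, meanEntry, hIJ]; ring
      · simp
    have h1 := hC.abs_sum_cliqueExt_sub_le hn hrn hYr x
    have h2 := hop.abs_sum_cross_sub_le hK Y x
    rw [← hA] at h1
    rw [← hB] at h2
    rw [hAB, abs_mul, abs_of_nonneg (coeff_nonneg _ _ _)]
    have h3 : expExt n (2 * r - Y.card) Y.card * (n * |B|) ≤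
        K * n ^ r * ∑ I : Above n r Y, x I.1 ^ 2 := by
      calc _ ≤ (n : ℝ) ^ Y.card * (K * n ^ (r - Y.card) * ∑ I : Above n r Y, x I.1 ^ 2) :=
            mul_le_mul (expExt_le _ _ _) h2 (by positivity) (by positivity)
        _ = K * (n ^ Y.card * n ^ (r - Y.card)) * ∑ I : Above n r Y, x I.1 ^ 2 := by ring
        _ = _ := by rw [← pow_add, Nat.add_sub_cancel' hYr]
    have h4 : |A + expExt n (2 * r - Y.card) Y.card * B| ≤
        |A| + expExt n (2 * r - Y.card) Y.card * |B| := by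
      refine (abs_add_le _ _).trans ?_
      rw [abs_mul, abs_of_nonneg (expExt_nonneg _ _ _)]
    calc n * (coeff k r Y.card * |A + expExt n (2 * r - Y.card) Y.card * B|)
        ≤ n * (coeff k r Y.card * (|A| + expExt n (2 * r - Y.card) Y.card * |B|)) := by
          have := coeff_nonneg k r Y.card
          gcongr
      _ = coeff k r Y.card * (n * |A| + expExt n (2 * r - Y.card) Y.card * (n * |B|)) := by ring
      _ ≤ coeff k r Y.card * (K * n ^ r * ∑ I : Above n r Y, x I.1 ^ 2 +
            K * n ^ r * ∑ I : Above n r Y, x I.1 ^ 2) :=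
          mul_le_mul_of_nonneg_left (add_le_add h1 h3) (coeff_nonneg _ _ _)
      _ = _ := by ring
  refine (mul_le_mul_of_nonneg_left (Finset.abs_sum_le_sum_abs _ _) (Nat.cast_nonneg _)).trans ?_
  rw [Finset.mul_sum]
  refine (Finset.sum_le_sum fun Y _ => hY Y).trans (le_of_eq ?_)
  rw [← Finset.mul_sum, sum_above_sq_eq (coeff k r)]; ring

end Deviation

/-! ### Positivity of the mean matrix -/

section Mean

open Finset

/-- The top term α l dominates the alternating sum: every other α i is at most α l / 2^(r+1), and
the binomial weights sum to at most 2^r. -/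
lemma half_le_fwdDiff_iter {α : ℕ → ℝ} {r : ℕ} (h0 : ∀ i, 0 ≤ α i)
    (hα : ∀ i < r, α i * 2 ^ (r + 1) ≤ α (i + 1)) {l : ℕ} (hl : l ≤ r) :
    α l / 2 ≤ (fwdDiff 1)^[l] α 0 := by
  have hstep : ∀ i < r, α i ≤ α (i + 1) := fun i hi =>
    (le_mul_of_one_le_right (h0 i) (one_le_pow₀ (by norm_num))).trans (hα i hi)
  have hmono : ∀ j ≤ r, ∀ i ≤ j, α i ≤ α j := by
    intro j
    induction j with
    | zero => intro _ i hi; rw [Nat.le_zero.1 hi]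
    | succ j ih =>
      intro hj i hi
      rcases Nat.eq_or_lt_of_le hi with rfl | hi
      · rfl
      · exact (ih (by omega) i (by omega)).trans (hstep j (by omega))
  have hlt : ∀ i < l, α i ≤ α l / 2 ^ (r + 1) := by
    intro i hi
    rw [le_div_iff₀ (by positivity)]
    exact (hα i (by omega)).trans (hmono l hl (i + 1) hi)
  rw [fwdDiff_iter_eq_sum_shift, sum_range_succ]
  have hlast : ((-1 : ℤ) ^ (l - l) * (l.choose l : ℤ)) • α (0 + l • 1) = α l := by simp
  rw [hlast]
  have hrest : |∑ i ∈ range l, ((-1 : ℤ) ^ (l - i) * (l.choose i : ℤ)) • α (0 + i • 1)| ≤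
      α l / 2 := by
    calc _ ≤ ∑ i ∈ range l, |((-1 : ℤ) ^ (l - i) * (l.choose i : ℤ)) • α (0 + i • 1)| :=
          abs_sum_le_sum_abs _ _
      _ ≤ ∑ i ∈ range l, (l.choose i : ℝ) * (α l / 2 ^ (r + 1)) := by
          refine sum_le_sum fun i hi => ?_
          rw [zsmul_eq_mul, abs_mul]
          push_cast
          rw [abs_mul, abs_pow, abs_neg, abs_one, one_pow, one_mul, Nat.abs_cast, zero_add,
            smul_eq_mul, mul_one, abs_of_nonneg (h0 i)]
          exact mul_le_mul_of_nonneg_left (hlt i (mem_range.1 hi)) (Nat.cast_nonneg _)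
      _ ≤ ∑ i ∈ range (l + 1), (l.choose i : ℝ) * (α l / 2 ^ (r + 1)) :=
          sum_le_sum_of_subset_of_nonneg (range_subset_range.2 (Nat.le_succ l)) fun _ _ _ =>
            mul_nonneg (Nat.cast_nonneg _) (div_nonneg (h0 l) (by positivity))
      _ = 2 ^ l * (α l / 2 ^ (r + 1)) := by
          rw [← sum_mul]; congr 1; exact_mod_cast Nat.sum_range_choose l
      _ ≤ 2 ^ r * (α l / 2 ^ (r + 1)) := by
          have := div_nonneg (h0 l) (show (0 : ℝ) ≤ 2 ^ (r + 1) by positivity)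
          gcongr; norm_num
      _ = α l / 2 := by rw [pow_succ]; field_simp
  linarith [neg_abs_le (∑ i ∈ range l, ((-1 : ℤ) ^ (l - i) * (l.choose i : ℤ)) • α (0 + i • 1))]

/-- binom(|I ∩ J|, l) counts the l-sets contained in both I and J, so the matrix is a Gram matrix.
-/
lemma sum_sum_mul_choose_card_inter {n r : ℕ} (l : ℕ) (x : Sub n r → ℝ) :
    ∑ I, ∑ J, x I * x J * ((I.1 ∩ J.1).card.choose l : ℝ) =
      ∑ Y ∈ powersetCard l (univ : Finset (Fin n)), (∑ I, if Y ⊆ I.1 then x I else 0) ^ 2 := by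
  have h : ∀ I J : Sub n r, ((I.1 ∩ J.1).card.choose l : ℝ) =
      ∑ Y ∈ powersetCard l (univ : Finset (Fin n)),
        (if Y ⊆ I.1 then 1 else 0) * (if Y ⊆ J.1 then (1 : ℝ) else 0) := by
    intro I J
    rw [← card_powersetCard, card_eq_sum_ones, Nat.cast_sum]
    simp_rw [ite_zero_mul_ite_zero, mul_one, ← subset_inter_iff]
    rw [← sum_filter]
    refine sum_congr ?_ fun _ _ => by simp
    ext Y; simp [mem_powersetCard, and_comm]
  simp_rw [h, sq, sum_mul_sum]
  symm
  rw [sum_comm]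
  refine sum_congr rfl fun I _ => ?_
  rw [sum_comm]
  refine sum_congr rfl fun J _ => ?_
  rw [mul_sum]
  refine sum_congr rfl fun Y _ => ?_
  split_ifs <;> simp

lemma choose_card_inter_self {n r : ℕ} (I J : Sub n r) :
    ((I.1 ∩ J.1).card.choose r : ℝ) = if I = J then 1 else 0 := by
  split_ifs with h
  · rw [h, inter_self, J.2, Nat.choose_self, Nat.cast_one]
  · rw [Nat.choose_eq_zero_of_lt, Nat.cast_zero]
    refine lt_of_le_of_ne ((card_le_card inter_subset_left).trans I.2.le) fun hc => h ?_
    have h1 : I.1 ∩ J.1 = I.1 := eq_of_subset_of_card_le inter_subset_left (by rw [hc, I.2])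
    have h2 : I.1 ∩ J.1 = J.1 := eq_of_subset_of_card_le inter_subset_right (by rw [hc, J.2])
    exact Subtype.ext (h1.symm.trans h2)

/-- A matrix in the Johnson scheme with rapidly increasing entries is well conditioned. -/
lemma half_mul_le_sum_card_inter {n r : ℕ} {α : ℕ → ℝ} (h0 : ∀ i, 0 ≤ α i)
    (hα : ∀ i < r, α i * 2 ^ (r + 1) ≤ α (i + 1)) (x : Sub n r → ℝ) :
    α r / 2 * ∑ I, x I ^ 2 ≤ ∑ I, ∑ J, x I * x J * α (I.1 ∩ J.1).card := by
  -- The Newton coefficients of α: α i = Σ binom(i, l) β l.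
  set β : ℕ → ℝ := fun l => (fwdDiff 1)^[l] α 0 with hβ
  have hexp : ∀ i ≤ r, α i = ∑ l ∈ range (r + 1), (i.choose l : ℝ) * β l := by
    intro i hi
    have h := shift_eq_sum_fwdDiff_iter 1 α i 0
    rw [zero_add, smul_eq_mul, mul_one] at h
    rw [h]
    simp_rw [nsmul_eq_mul]
    refine sum_subset (range_subset_range.2 (by omega)) fun l _ hl => ?_
    rw [Nat.choose_eq_zero_of_lt (by simpa using hl), Nat.cast_zero, zero_mul]
  have hquad : ∑ I, ∑ J, x I * x J * α (I.1 ∩ J.1).card =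
      ∑ l ∈ range (r + 1), β l * ∑ I, ∑ J, x I * x J * ((I.1 ∩ J.1).card.choose l : ℝ) := by
    simp_rw [mul_sum]
    symm
    rw [sum_comm]
    refine sum_congr rfl fun I _ => ?_
    rw [sum_comm]
    refine sum_congr rfl fun J _ => ?_
    rw [hexp _ ((card_le_card inter_subset_left).trans I.2.le), mul_sum]
    exact sum_congr rfl fun l _ => by ring
  have hlast : ∑ I, ∑ J, x I * x J * ((I.1 ∩ J.1).card.choose r : ℝ) = ∑ I, x I ^ 2 := by
    simp_rw [choose_card_inter_self]
    exact sum_congr rfl fun I _ => by simp [sq]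
  rw [hquad, sum_range_succ, hlast]
  have hβ0 : ∀ l ≤ r, α l / 2 ≤ β l := fun l hl => half_le_fwdDiff_iter h0 hα hl
  have h1 : 0 ≤ ∑ l ∈ range r, β l * ∑ I, ∑ J, x I * x J * ((I.1 ∩ J.1).card.choose l : ℝ) := by
    refine sum_nonneg fun l hl => ?_
    rw [sum_sum_mul_choose_card_inter]
    have := hβ0 l (mem_range.1 hl).le
    exact mul_nonneg (by linarith [h0 l]) (sum_nonneg fun _ _ => sq_nonneg _)
  have h2 : α r / 2 * ∑ I, x I ^ 2 ≤ β r * ∑ I, x I ^ 2 :=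
    mul_le_mul_of_nonneg_right (hβ0 r le_rfl) (sum_nonneg fun _ _ => sq_nonneg _)
  linarith

end Mean

/-! ### The deterministic criterion -/

/-- A deterministic criterion for positive definiteness. -/
lemma filledMatrix_posDef {n r k : ℕ} {G : SimpleGraph (Fin n)} {K : ℝ} (hn : 0 < n)
    (hrn : 2 * r ≤ n) (hop : OpBound G K) (hC : ComBound G (2 * r) K)
    (hα : ∀ i < r, meanEntry n k r i * 2 ^ (r + 1) ≤ meanEntry n k r (i + 1))
    (hK : 2 * K * n ^ r * (∑ i ∈ Finset.range (r + 1), (r.choose i : ℝ) * coeff k r i) <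
      n * (meanEntry n k r r / 2)) : (filledMatrix G k r).PosDef := by
  have hn' : (0 : ℝ) < n := by exact_mod_cast hn
  refine filledMatrix_posDef_of_forall fun x hx => ?_
  have hx2 : 0 < ∑ I, x I ^ 2 := by
    obtain ⟨I, hI⟩ := Function.ne_iff.1 hx
    exact Finset.sum_pos' (fun _ _ => sq_nonneg _)
      ⟨I, Finset.mem_univ I, by have : x I ≠ 0 := hI; positivity⟩
  have h0 : ∀ i, 0 ≤ meanEntry n k r i := fun i =>
    mul_nonneg (coeff_nonneg _ _ _) (mul_nonneg (expExt_nonneg _ _ _) (by positivity))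
  have h1 := half_mul_le_sum_card_inter h0 hα x
  have h2 := abs_sum_filledMatrix_sub_le hn hrn hop hC k x
  set D := ∑ I, ∑ J, x I * x J *
        (filledMatrix G k r I J - meanEntry n k r (I.1 ∩ J.1).card) with hD
  have h3 : ∑ I, ∑ J, x I * x J * filledMatrix G k r I J =
      ∑ I, ∑ J, x I * x J * meanEntry n k r (I.1 ∩ J.1).card + D := by
    rw [hD, ← Finset.sum_add_distrib]
    refine Finset.sum_congr rfl fun I _ => ?_
    rw [← Finset.sum_add_distrib]
    exact Finset.sum_congr rfl fun J _ => by ring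
  rw [h3]
  have h4 : n * |D| < n * (meanEntry n k r r / 2 * ∑ I, x I ^ 2) := by
    rw [← mul_assoc]
    exact h2.trans_lt (mul_lt_mul_of_pos_right hK hx2)
  have h5 := lt_of_mul_lt_mul_left h4 hn'.le
  linarith [neg_abs_le D]

/-! ### Estimates for the coefficients and the mean entries -/

lemma choose_succ_le_mul (k m : ℕ) : k.choose (m + 1) ≤ k.choose m * k := by
  calc k.choose (m + 1) ≤ k.choose (m + 1) * (m + 1) := Nat.le_mul_of_pos_right _ (Nat.succ_pos _)
    _ = k.choose m * (k - m) := Nat.choose_succ_right_eq k m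
    _ ≤ _ := Nat.mul_le_mul_left _ (Nat.sub_le _ _)

lemma choose_add_le_mul_pow (k m d : ℕ) : k.choose (m + d) ≤ k.choose m * k ^ d := by
  induction d with
  | zero => simp
  | succ d ih =>
    calc k.choose (m + (d + 1)) ≤ k.choose (m + d) * k := choose_succ_le_mul k (m + d)
      _ ≤ k.choose m * k ^ d * k := Nat.mul_le_mul_right _ ih
      _ = _ := by ring

lemma choose_two_mul_le (r m : ℕ) : ((2 * r).choose m : ℝ) ≤ 4 ^ r := by
  have h : (2 * r).choose m ≤ 2 ^ (2 * r) := Nat.choose_le_two_pow _ _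
  rw [pow_mul] at h
  exact_mod_cast h

lemma coeff_le_choose (k r i : ℕ) : coeff k r i ≤ k.choose (2 * r - i) := by
  unfold coeff
  refine div_le_self (Nat.cast_nonneg _) ?_
  exact_mod_cast Nat.choose_pos (Nat.sub_le _ _)

lemma choose_le_coeff (k r i : ℕ) : (k.choose (2 * r - i) : ℝ) ≤ 4 ^ r * coeff k r i := by
  have h : (0 : ℝ) < (2 * r).choose (2 * r - i) := by
    exact_mod_cast Nat.choose_pos (Nat.sub_le _ _)
  unfold coeff
  rw [← mul_div_assoc, le_div_iff₀ h, mul_comm]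
  exact mul_le_mul_of_nonneg_right (choose_two_mul_le _ _) (Nat.cast_nonneg _)

lemma coeff_le_mul_succ {k r i : ℕ} (hi : i < r) :
    coeff k r i ≤ k * 4 ^ r * coeff k r (i + 1) := by
  have h1 : 2 * r - i = 2 * r - (i + 1) + 1 := by omega
  calc coeff k r i ≤ k.choose (2 * r - i) := coeff_le_choose _ _ _
    _ ≤ k.choose (2 * r - (i + 1)) * k := by rw [h1]; exact_mod_cast choose_succ_le_mul _ _
    _ ≤ (4 ^ r * coeff k r (i + 1)) * k := by gcongr; exact choose_le_coeff _ _ _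
    _ = _ := by ring

lemma coeff_le_mul_self {k r i : ℕ} (hk : 1 ≤ k) (hi : i ≤ r) :
    coeff k r i ≤ 4 ^ r * k ^ r * coeff k r r := by
  have h1 : 2 * r - i = (2 * r - r) + (r - i) := by omega
  have hk' : (1 : ℝ) ≤ k := by exact_mod_cast hk
  have hc := coeff_nonneg k r r
  calc coeff k r i ≤ k.choose (2 * r - i) := coeff_le_choose _ _ _
    _ ≤ k.choose (2 * r - r) * k ^ (r - i) := by
        rw [h1]; exact_mod_cast choose_add_le_mul_pow _ _ _
    _ ≤ (4 ^ r * coeff k r r) * k ^ r := by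
        refine mul_le_mul (choose_le_coeff _ _ _) (pow_le_pow_right₀ hk' (Nat.sub_le _ _))
          (by positivity) (by positivity)
    _ = _ := by ring

lemma sum_choose_mul_coeff_le {k r : ℕ} (hk : 1 ≤ k) :
    ∑ i ∈ Finset.range (r + 1), (r.choose i : ℝ) * coeff k r i ≤ 8 ^ r * k ^ r * coeff k r r := by
  calc _ ≤ ∑ i ∈ Finset.range (r + 1), (r.choose i : ℝ) * (4 ^ r * k ^ r * coeff k r r) := by
        refine Finset.sum_le_sum fun i hi => ?_
        exact mul_le_mul_of_nonneg_left
          (coeff_le_mul_self hk (Nat.lt_succ_iff.1 (Finset.mem_range.1 hi))) (Nat.cast_nonneg _)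
    _ = 2 ^ r * (4 ^ r * k ^ r * coeff k r r) := by
        rw [← Finset.sum_mul]; congr 1; exact_mod_cast Nat.sum_range_choose r
    _ = _ := by rw [show (8 : ℝ) = 2 * 4 by norm_num, mul_pow]; ring

lemma coeff_self_pos {k r : ℕ} (hk : r ≤ k) : 0 < coeff k r r := by
  unfold coeff
  have h1 : 0 < k.choose (2 * r - r) := Nat.choose_pos (by omega)
  have h2 : 0 < (2 * r).choose (2 * r - r) := Nat.choose_pos (by omega)
  positivity

/-- The exponents add up as i(2r − i) + (r − i)² = r², so the power of 1/2 depends on i only through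
binom(i, 2). -/
lemma meanEntry_eq {n k r i : ℕ} (hi : i ≤ r) :
    meanEntry n k r i =
      coeff k r i * (((n - (2 * r - i)).choose i : ℝ) * (1 / 2) ^ (r * r + i.choose 2)) := by
  obtain ⟨d, rfl⟩ := Nat.exists_eq_add_of_le hi
  have h1 : 2 * (i + d) - i = i + 2 * d := by omega
  have h2 : i + d - i = d := by omega
  rw [meanEntry, expExt, mul_assoc ((n - _ : ℕ).choose i : ℝ), ← pow_add]
  congr 3
  rw [h1, h2]; ring

/-- One more common element costs at most k 4^r in the coefficient and 2^i in edge probability, but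
gains at least n/(2r) in the choice of extensions. The bound r ≤ 2^r turns all the losses into k
2^(5r+2). -/
lemma meanEntry_succ_le {n k r i : ℕ} (hrn : 4 * r ≤ n) (hi : i < r) :
    n * (meanEntry n k r i * 2 ^ (r + 1)) ≤ (k * 2 ^ (5 * r + 2)) * meanEntry n k r (i + 1) := by
  rw [meanEntry_eq hi.le, meanEntry_eq hi]
  obtain ⟨N, hN⟩ : ∃ N, n - (2 * r - i) = N := ⟨_, rfl⟩
  have hN1 : n - (2 * r - (i + 1)) = N + 1 := by omega
  rw [hN, hN1]
  have h1 : (n : ℝ) * (N.choose i : ℝ) ≤ 2 * r * ((N + 1).choose (i + 1) : ℝ) := by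
    have e := Nat.add_one_mul_choose_eq N i
    have : n * N.choose i ≤ 2 * r * (N + 1).choose (i + 1) := by
      calc n * N.choose i ≤ 2 * (N + 1) * N.choose i := Nat.mul_le_mul_right _ (by omega)
        _ = 2 * ((N + 1).choose (i + 1) * (i + 1)) := by rw [mul_assoc, e]
        _ ≤ 2 * ((N + 1).choose (i + 1) * r) := by gcongr; omega
        _ = _ := by ring
    exact_mod_cast this
  have h2 : (1 / 2 : ℝ) ^ (r * r + i.choose 2) ≤
      2 ^ r * (1 / 2) ^ (r * r + (i + 1).choose 2) := by
    have e : r * r + (i + 1).choose 2 = i + (r * r + i.choose 2) := by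
      rw [Nat.choose_succ_succ' i 1, Nat.choose_one_right]; ring
    rw [e, pow_add _ i, ← mul_assoc]
    refine le_mul_of_one_le_left (by positivity) ?_
    calc (1 : ℝ) = 2 ^ i * (1 / 2) ^ i := by rw [← mul_pow]; norm_num
      _ ≤ 2 ^ r * (1 / 2) ^ i := by gcongr; norm_num
  have h3 := coeff_le_mul_succ (k := k) hi
  have h4 : (r : ℝ) ≤ 2 ^ r := by exact_mod_cast (Nat.lt_two_pow_self (n := r)).le
  have hc := coeff_nonneg k r i
  have hc' := coeff_nonneg k r (i + 1)
  calc (n : ℝ) * (coeff k r i * ((N.choose i : ℝ) * (1 / 2) ^ (r * r + i.choose 2)) * 2 ^ (r + 1))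
      = coeff k r i * (n * (N.choose i : ℝ)) * (1 / 2) ^ (r * r + i.choose 2) * 2 ^ (r + 1) := by
        ring
    _ ≤ (k * 4 ^ r * coeff k r (i + 1)) * (2 * 2 ^ r * ((N + 1).choose (i + 1) : ℝ)) *
        (2 ^ r * (1 / 2) ^ (r * r + (i + 1).choose 2)) * 2 ^ (r + 1) := by
        refine mul_le_mul_of_nonneg_right (mul_le_mul (mul_le_mul h3 (h1.trans ?_) ?_ ?_) h2 ?_ ?_)
          ?_ <;> first | positivity | gcongr
    _ = _ := by
        rw [show (4 : ℝ) = 2 * 2 by norm_num, mul_pow,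
          show 5 * r + 2 = r + r + r + r + r + 2 by ring]
        simp only [pow_add]; ring

/-- binom(n − r, r) ≥ (n/2)^r / r! with r! ≤ 2^(r²); the edge probability costs at most a further
2^(2r²). -/
lemma le_meanEntry_self {n k r : ℕ} (hrn : 4 * r ≤ n) :
    coeff k r r * (n ^ r * (1 / 2) ^ (r + 3 * (r * r))) ≤ meanEntry n k r r := by
  rw [meanEntry_eq le_rfl]
  have hc := coeff_nonneg k r r
  refine mul_le_mul_of_nonneg_left ?_ hc
  have h1 : ((n : ℝ) / 2) ^ r ≤ ((n - r + 1 - r : ℕ) : ℝ) ^ r := by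
    gcongr
    rw [div_le_iff₀ (by norm_num)]
    exact_mod_cast (by omega : n ≤ (n - r + 1 - r) * 2)
  have h2 : (r.factorial : ℝ) ≤ 2 ^ (r * r) := by
    have : r.factorial ≤ 2 ^ (r * r) :=
      r.factorial_le_pow.trans (by rw [pow_mul]; exact Nat.pow_le_pow_left Nat.lt_two_pow_self.le r)
    exact_mod_cast this
  have h3 : (n : ℝ) ^ r * (1 / 2) ^ (r + r * r) ≤ ((n - r).choose r : ℝ) := by
    refine le_trans ?_ (Nat.pow_le_choose (α := ℝ) r (n - r))
    rw [le_div_iff₀ (by positivity)]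
    calc (n : ℝ) ^ r * (1 / 2) ^ (r + r * r) * r.factorial
        ≤ (n : ℝ) ^ r * (1 / 2) ^ (r + r * r) * 2 ^ (r * r) := by gcongr
      _ = ((n : ℝ) / 2) ^ r * ((1 / 2) ^ (r * r) * 2 ^ (r * r)) := by
          rw [pow_add, div_eq_mul_one_div (n : ℝ) 2, mul_pow]; ring
      _ = ((n : ℝ) / 2) ^ r := by rw [← mul_pow]; norm_num
      _ ≤ _ := h1
  have h4 : r.choose 2 ≤ r * r := (Nat.choose_le_pow r 2).trans (by rw [sq])
  rw [show 2 * r - r = r by omega]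
  calc (n : ℝ) ^ r * (1 / 2) ^ (r + 3 * (r * r))
      = ((n : ℝ) ^ r * (1 / 2) ^ (r + r * r)) * (1 / 2) ^ (r * r + r * r) := by
        rw [mul_assoc, ← pow_add]; congr 2; ring
    _ ≤ ((n - r).choose r : ℝ) * (1 / 2) ^ (r * r + r.choose 2) := by
        refine mul_le_mul h3 ?_ (by positivity) (by positivity)
        exact pow_le_pow_of_le_one (by norm_num) (by norm_num) (by omega)

/-! ### The range of k and the conclusion -/

-- Taking r-th powers turns 2^(-cr) into 2^(-cr²), which leaves room for the losses of order
-- 2^(O(r²)).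
open Real in
lemma pow_mul_lt_sqrt {n r k : ℕ} {c : ℝ} (hc : 20 ≤ c) (hr : 1 ≤ r) (hL : 0 < log n)
    (h : (k : ℝ) < (2 : ℝ) ^ (-(c * (r : ℝ))) * (√(n : ℝ) / log (n : ℝ)) ^ (1 / (r : ℝ))) :
    (k : ℝ) ^ r * 2 ^ (20 * (r * r)) * log n < √n := by
  have hr0 : r ≠ 0 := by omega
  have h1 := pow_lt_pow_left₀ h (Nat.cast_nonneg k) hr0
  rw [mul_pow, one_div, rpow_inv_natCast_pow (by positivity) hr0, ← rpow_natCast (_ ^ (-(c * _))),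
    ← rpow_mul (by norm_num)] at h1
  have h2 : (2 : ℝ) ^ (-(c * (r : ℝ)) * r) ≤ ((2 : ℝ) ^ (20 * (r * r)))⁻¹ := by
    rw [← rpow_natCast, ← rpow_neg (by norm_num)]
    refine rpow_le_rpow_of_exponent_le (by norm_num) ?_
    push_cast
    have : (0 : ℝ) ≤ (r : ℝ) * r := by positivity
    nlinarith
  have h3 : (k : ℝ) ^ r < ((2 : ℝ) ^ (20 * (r * r)))⁻¹ * (√n / log n) :=
    h1.trans_le (by gcongr)
  rw [inv_mul_eq_div, lt_div_iff₀ (by positivity), lt_div_iff₀ hL] at h3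
  exact h3

open Real in
lemma filledMatrix_posDef_of_bounds {n r k : ℕ} {G : SimpleGraph (Fin n)} (hr : 1 ≤ r)
    (hrk : r ≤ k) (hn : 0 < n) (hrn : 4 * r ≤ n) (hL : 1 ≤ log n)
    (hk : (k : ℝ) ^ r * 2 ^ (20 * (r * r)) * log n < √n)
    (hop : OpBound G (28 * (√n * log n))) (hC : ComBound G (2 * r) (28 * (√n * log n))) :
    (filledMatrix G k r).PosDef := by
  have hn' : (0 : ℝ) < n := by exact_mod_cast hn
  have hn1 : (1 : ℝ) ≤ n := by exact_mod_cast hn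
  have hk1 : (1 : ℝ) ≤ k := by exact_mod_cast hr.trans hrk
  have hsn : √(n : ℝ) ≤ n := by rw [sqrt_le_left hn'.le]; nlinarith
  have hrr : r ≤ r * r := Nat.le_mul_self r
  refine filledMatrix_posDef hn (by omega) hop hC (fun i hi => ?_) ?_
  · have h1 := meanEntry_succ_le (k := k) hrn hi
    have h0 : 0 ≤ meanEntry n k r (i + 1) :=
      mul_nonneg (coeff_nonneg _ _ _) (mul_nonneg (expExt_nonneg _ _ _) (by positivity))
    refine le_of_mul_le_mul_left (h1.trans (mul_le_mul_of_nonneg_right ?_ h0)) hn'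
    calc (k : ℝ) * 2 ^ (5 * r + 2) ≤ k ^ r * 2 ^ (20 * (r * r)) := by
          gcongr
          · exact le_self_pow₀ hk1 (by omega)
          · norm_num
          · omega
      _ ≤ k ^ r * 2 ^ (20 * (r * r)) * log n := le_mul_of_one_le_right (by positivity) hL
      _ ≤ n := hk.le.trans hsn
  · have hc := coeff_self_pos hrk
    set X : ℝ := coeff k r r * n ^ r with hX
    have hX0 : 0 < X := by positivity
    have h1 : 2 * (28 * (√n * log n)) * n ^ r *
        (∑ i ∈ Finset.range (r + 1), (r.choose i : ℝ) * coeff k r i) ≤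
        X * (√n * (56 * 8 ^ r * (k ^ r * log n))) := by
      calc _ ≤ 2 * (28 * (√n * log n)) * n ^ r * (8 ^ r * k ^ r * coeff k r r) := by
            gcongr; exact sum_choose_mul_coeff_le (hr.trans hrk)
        _ = _ := by rw [hX]; ring
    have h2 : X * (n * (1 / 2) ^ (r + 3 * (r * r)) / 2) ≤ n * (meanEntry n k r r / 2) := by
      have := le_meanEntry_self (k := k) hrn
      calc _ = n * ((coeff k r r * (n ^ r * (1 / 2) ^ (r + 3 * (r * r)))) / 2) := by
            rw [hX]; ring
        _ ≤ _ := by gcongr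
    refine h1.trans_lt (lt_of_lt_of_le (mul_lt_mul_of_pos_left ?_ hX0) h2)
    -- With 112 ≤ 2^7, the exponent 7 + 4r + 3r² is at most 14r² because r ≥ 1.
    have hP : (112 : ℝ) * 8 ^ r * 2 ^ (r + 3 * (r * r)) ≤ 2 ^ (20 * (r * r)) := by
      calc (112 : ℝ) * 8 ^ r * 2 ^ (r + 3 * (r * r))
          ≤ 2 ^ 7 * 8 ^ r * 2 ^ (r + 3 * (r * r)) := by gcongr; norm_num
        _ = 2 ^ (7 + 3 * r + (r + 3 * (r * r))) := by
            rw [show (8 : ℝ) = 2 ^ 3 by norm_num, ← pow_mul, ← pow_add, ← pow_add]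
        _ ≤ _ := pow_le_pow_right₀ (by norm_num) (by omega)
    set Q : ℝ := 2 ^ (r + 3 * (r * r)) with hQ
    have hQ0 : 0 < Q := by positivity
    have hQinv : (1 / 2 : ℝ) ^ (r + 3 * (r * r)) = 1 / Q := by rw [one_div_pow]
    rw [hQinv, mul_one_div, div_div, lt_div_iff₀ (by positivity)]
    calc √n * (56 * 8 ^ r * (k ^ r * log n)) * (Q * 2)
        = √n * ((112 * 8 ^ r * Q) * (k ^ r * log n)) := by ring
      _ ≤ √n * (2 ^ (20 * (r * r)) * (k ^ r * log n)) := by gcongr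
      _ = √n * (k ^ r * 2 ^ (20 * (r * r)) * log n) := by ring
      _ < √n * √n := mul_lt_mul_of_pos_left hk (sqrt_pos.2 hn')
      _ = n := mul_self_sqrt hn'.le

-- Since k ≥ 1, the bound on k also forces 2^(20r) ≤ √n, so r is at most logarithmic in n. This
-- permits `ComBound` with m = 2r and makes the result uniform in r.
open Real in
lemma two_mul_le_log {n r k : ℕ} (hr : 1 ≤ r) (hrk : r ≤ k) (hn : 0 < n) (hL : 1 ≤ log n)
    (hk : (k : ℝ) ^ r * 2 ^ (20 * (r * r)) * log n < √n) : ((2 * r : ℕ) : ℝ) ≤ log n := by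
  have hn' : (0 : ℝ) < n := by exact_mod_cast hn
  have hk1 : (1 : ℝ) ≤ k := by exact_mod_cast hr.trans hrk
  have hrr : r ≤ r * r := Nat.le_mul_self r
  have h1 : (2 : ℝ) ^ (20 * r) ≤ √n := by
    calc (2 : ℝ) ^ (20 * r) ≤ 2 ^ (20 * (r * r)) :=
          pow_le_pow_right₀ (by norm_num) (by omega)
      _ ≤ k ^ r * 2 ^ (20 * (r * r)) * log n := by
          have := one_le_pow₀ hk1 (n := r)
          rw [mul_right_comm]
          exact le_mul_of_one_le_left (by positivity) (by nlinarith)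
      _ ≤ _ := hk.le
  have h2 := log_le_log (by positivity) h1
  rw [log_pow, log_sqrt hn'.le] at h2
  push_cast at h2 ⊢
  have h3 := log_two_gt_d9
  have h4 : (0 : ℝ) ≤ r := Nat.cast_nonneg r
  nlinarith

end PlantedClique

theorem mainTheorem5 :
    ∃ c₀ : ℝ, 0 < c₀ ∧ ∀ c : ℝ, c₀ ≤ c →
      ∀ ε : ℝ, 0 < ε → ∃ N : ℕ, ∀ n : ℕ, N ≤ n →
        ∀ r k : ℕ, 1 ≤ r → r ≤ k →
          (k : ℝ) < (2 : ℝ) ^ (-(c * (r : ℝ))) *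
            (Real.sqrt (n : ℝ) / Real.log (n : ℝ)) ^ (1 / (r : ℝ)) →
          1 - ε ≤ (PlantedClique.gnHalf n).real
            {G : SimpleGraph (Fin n) | (PlantedClique.filledMatrix G k r).PosDef} := by
  -- The total failure probability is 3/n, hence the threshold 3/ε; n ≥ 4 ensures log n ≥ 1.
  refine ⟨20, by norm_num, fun c hc ε hε => ⟨max 4 ⌈3 / ε⌉₊, fun n hN r k hr hrk hlt => ?_⟩⟩
  have hn4 : 4 ≤ n := (le_max_left _ _).trans hN
  have hn4' : (4 : ℝ) ≤ n := by exact_mod_cast hn4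
  have hn0 : (0 : ℝ) < n := by linarith
  have hL1 : 1 ≤ Real.log n := by
    rw [Real.le_log_iff_exp_le hn0]; linarith [Real.exp_one_lt_d9]
  have hk := PlantedClique.pow_mul_lt_sqrt hc hr (by linarith) hlt
  have h2r := PlantedClique.two_mul_le_log hr hrk (by omega) hL1 hk
  have hrn : 4 * r ≤ n := by
    have h1 : Real.log n ≤ n / 2 := by
      have h := Real.log_le_sub_one_of_pos (show (0 : ℝ) < n / 2 by linarith)
      rw [Real.log_div hn0.ne' (by norm_num)] at h
      linarith [Real.log_two_lt_d9]
    have h2 : ((2 * r : ℕ) : ℝ) ≤ n / 2 := h2r.trans h1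
    have h3 : ((4 * r : ℕ) : ℝ) ≤ n := by push_cast at h2 ⊢; linarith
    exact_mod_cast h3
  have hε' : 3 / (n : ℝ) ≤ ε := by
    have h1 : 3 / ε ≤ n :=
      (Nat.le_ceil _).trans (by exact_mod_cast (le_max_right _ _).trans hN)
    rw [div_le_iff₀ hε] at h1
    rw [div_le_iff₀ hn0]; linarith
  refine (by linarith : 1 - ε ≤ 1 - 3 / (n : ℝ)).trans
    ((PlantedClique.le_measureReal_opBound_and_comBound hn4 h2r).trans
      (measureReal_mono (fun G hG => ?_) (measure_ne_top _ _)))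
  exact PlantedClique.filledMatrix_posDef_of_bounds hr hrk (by omega) hrn hL1 hk hG.1 hG.2
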